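/- Let $0 < n_1 < \dots < n_d < n$ be integers, and put $n_0 = 0$, $n_{d+1} = n$. Let $\mathrm{Flag}(n_1,\dots,n_d;n)$ be the manifold of flags $\mathbb V_1 \subsetneq \dots \subsetneq \mathbb V_d$ of linear subspaces of $\mathbb R^n$ with $\dim \mathbb V_i = n_i$ for $i=1,\dots,d$, with its smooth structure as a submanifold of the product of Grassmannians $\mathrm{Gr}(n_1,n)\times\dots\times\mathrm{Gr}(n_d,n)$, where $\mathrm{Gr}(m,n)$ is identified with the set of orthogonal projections of rank $m$ in $\mathbb R^{n\times n}$. Let $\mathrm S(\mathrm O(n_1)\times\mathrm O(n_2-n_1)\times\dots\times\mathrm O(n-n_d))$ be the subgroup of $\mathrm{SO}(n)$ consisting of the block-diagonal matrices $\mathrm{diag}(Q_1,\dots,Q_{d+1})$ with $Q_j\in\mathrm O(n_j-n_{j-1})$ for $j=1,\dots,d+1$ and $\prod_{j=1}^{d+1}\det Q_j = 1$. Then $\mathrm{SO}(n)$, as a submanifold of $\mathbb R^{n\times n}$, is a compact connected Lie group, it acts smoothly by left translation on the homogeneous space $$\mathrm{SO}(n)/\mathrm S\bigl(\mathrm O(n_1)\times\mathrm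 O(n_2-n_1)\times\dots\times\mathrm O(n-n_d)\bigr),$$ which carries the quotient smooth structure, and $\mathrm{Flag}(n_1,\dots,n_d;n)$ is diffeomorphic to this homogeneous space. -/

import Mathlib

open scoped Manifold ContDiff Topology
open Matrix InnerProductSpace

/-! ### Embedded submanifolds of normed spaces -/

section Submanifold

/-- An admissible chart of the subset `ι(M)` of the normed space `E`: its inverse is smooth as a map
into `E`, and the chart is locally the restriction of a smooth map defined on `E`. -/
structure IsSubmanifoldChart {M E F : Type*} [TopologicalSpace M]
    [NormedAddCommGroup E] [NormedSpace ℝ E] [NormedAddCommGroup F] [NormedSpace ℝ F]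
    (ι : M → E) (e : OpenPartialHomeomorph M F) : Prop where
  contDiffOn_symm : ContDiffOn ℝ ∞ (ι ∘ e.symm) e.target
  exists_extension : ∀ x ∈ e.source, ∃ φ : E → F,
    ContDiffAt ℝ ∞ φ (ι x) ∧ ∀ᶠ y in 𝓝 x, e y = φ (ι y)

/-- The manifold structure of an embedded submanifold `ι : M → E`: the atlas consists of
all admissible charts. -/
@[reducible]
noncomputable def submanifoldChartedSpace {M E F : Type*} [TopologicalSpace M]
    [NormedAddCommGroup E] [NormedSpace ℝ E] [NormedAddCommGroup F] [NormedSpace ℝ F]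
    (ι : M → E)
    (h : ∀ x, ∃ e : OpenPartialHomeomorph M F, IsSubmanifoldChart ι e ∧ x ∈ e.source) :
    ChartedSpace F M where
  atlas := {e | IsSubmanifoldChart ι e}
  chartAt x := (h x).choose
  mem_chart_source x := (h x).choose_spec.2
  chart_mem_atlas x := (h x).choose_spec.1

variable {M E F : Type*} [TopologicalSpace M]
    [NormedAddCommGroup E] [NormedSpace ℝ E] [NormedAddCommGroup F] [NormedSpace ℝ F]

theorem IsSubmanifoldChart.isManifold {ι : M → E} [ChartedSpace F M]
    (h : ∀ e ∈ atlas F M, IsSubmanifoldChart ι e) : IsManifold 𝓘(ℝ, F) ∞ M := by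
  refine isManifold_of_contDiffOn _ _ _ fun e e' he he' => ?_
  simp only [modelWithCornersSelf_coe, modelWithCornersSelf_coe_symm, Function.id_comp,
    Function.comp_id, Set.preimage_id, Set.range_id, Set.inter_univ]
  intro x hx
  have hx1 : x ∈ e.target := by simpa using hx.1
  have hx2 : e.symm x ∈ e'.source := by simpa using hx.2
  obtain ⟨φ, hφ, hev⟩ := (h e' he').exists_extension _ hx2
  have h1 : ContDiffAt ℝ ∞ (ι ∘ e.symm) x :=
    (h e he).contDiffOn_symm.contDiffAt (e.open_target.mem_nhds hx1)
  have h2 : ContDiffAt ℝ ∞ (φ ∘ (ι ∘ e.symm)) x := ContDiffAt.comp x hφ h1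
  refine (h2.congr_of_eventuallyEq ?_).contDiffWithinAt
  filter_upwards [(e.continuousAt_symm hx1).eventually hev] with y hy
  simpa using hy

theorem IsSubmanifoldChart.contMDiff_embedding {ι : M → E} [ChartedSpace F M]
    (hι : Continuous ι)
    (h : ∀ e ∈ atlas F M, IsSubmanifoldChart ι e) : ContMDiff 𝓘(ℝ, F) 𝓘(ℝ, E) ∞ ι := by
  intro x
  rw [contMDiffAt_iff]
  refine ⟨hι.continuousAt, ?_⟩
  have hx := mem_chart_source F x
  have h1 := (h _ (chart_mem_atlas F x)).contDiffOn_symm.contDiffAt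
    ((chartAt F x).open_target.mem_nhds ((chartAt F x).map_source hx))
  simpa [extChartAt, Function.comp_def, chartAt_self_eq] using h1.contDiffWithinAt

theorem IsSubmanifoldChart.contMDiff_of_comp {ι : M → E} [ChartedSpace F M]
    (hι : Topology.IsInducing ι) (h : ∀ e ∈ atlas F M, IsSubmanifoldChart ι e)
    {G H N : Type*} [NormedAddCommGroup G] [NormedSpace ℝ G] [TopologicalSpace H]
    {I : ModelWithCorners ℝ G H} [TopologicalSpace N] [ChartedSpace H N] {f : N → M}
    (hf : ContMDiff I 𝓘(ℝ, E) ∞ (ι ∘ f)) : ContMDiff I 𝓘(ℝ, F) ∞ f := by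
  intro x
  have hc : Continuous f := hι.continuous_iff.2 hf.continuous
  rw [contMDiffAt_iff_target]
  refine ⟨hc.continuousAt, ?_⟩
  obtain ⟨φ, hφ, hev⟩ :=
    (h _ (chart_mem_atlas F (f x))).exists_extension _ (mem_chart_source F (f x))
  have h1 : ContMDiffAt I 𝓘(ℝ, F) ∞ (φ ∘ (ι ∘ f)) x :=
    ContMDiffAt.comp x hφ.contMDiffAt (hf x)
  refine h1.congr_of_eventuallyEq ?_
  filter_upwards [hc.continuousAt.eventually hev] with y hy
  simpa [extChartAt] using hy

theorem exists_isSubmanifoldChart {ι : M → E} (hι : Topology.IsInducing ι) {U : Set E}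
    (hU : IsOpen U) {φ : E → F} (hφ : ContDiffOn ℝ ∞ φ U) {ψ : F → M}
    (hψ : ContDiff ℝ ∞ (ι ∘ ψ)) (hψU : ∀ x, ι (ψ x) ∈ U) (hφψ : ∀ x, φ (ι (ψ x)) = x)
    (hψφ : ∀ m, ι m ∈ U → ψ (φ (ι m)) = m) :
    ∃ e : OpenPartialHomeomorph M F, IsSubmanifoldChart ι e ∧ e.source = ι ⁻¹' U := by
  refine ⟨{ toFun := fun m => φ (ι m)
            invFun := ψ
            source := ι ⁻¹' U
            target := Set.univ
            map_source' := fun _ _ => trivial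
            map_target' := fun x _ => hψU x
            left_inv' := fun m hm => hψφ m hm
            right_inv' := fun x _ => hφψ x
            open_source := hU.preimage hι.continuous
            open_target := isOpen_univ
            continuousOn_toFun :=
              hφ.continuousOn.comp hι.continuous.continuousOn fun _ h => h
            continuousOn_invFun := (hι.continuous_iff.2 hψ.continuous).continuousOn },
          ⟨hψ.contDiffOn, fun x hx => ⟨φ, hφ.contDiffAt (hU.mem_nhds hx), ?_⟩⟩, rfl⟩
  exact Filter.Eventually.of_forall fun _ => rfl

end Submanifold

/-! ### The special orthogonal group as a manifold of matrices -/

section SpecialOrthogonal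

/-- The Euclidean space `ℝⁿ`. -/
abbrev Eucl (n : ℕ) : Type := EuclideanSpace ℝ (Fin n)

/-- The special orthogonal group `SO(n)`. -/
abbrev SO (n : ℕ) : Type := Matrix.specialOrthogonalGroup (Fin n) ℝ

/-- The inclusion of `SO(n)` into the normed space of linear endomorphisms of `ℝⁿ`, that is,
into the `n × n` matrices. -/
noncomputable def SO.toEnd {n : ℕ} (A : SO n) : Eucl n →L[ℝ] Eucl n :=
  Matrix.toEuclideanCLM (n := Fin n) (𝕜 := ℝ) (A : Matrix (Fin n) (Fin n) ℝ)

/-- Coordinates for the skew-symmetric matrices: the entries above the diagonal. -/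
abbrev SkewModel (n : ℕ) : Type := EuclideanSpace ℝ {p : Fin n × Fin n // p.1 < p.2}

theorem SO.isInducing_toEnd (n : ℕ) : Topology.IsInducing (SO.toEnd (n := n)) := by
  let L : Matrix (Fin n) (Fin n) ℝ ≃ₗ[ℝ] (Eucl n →L[ℝ] Eucl n) :=
    (Matrix.toEuclideanCLM (n := Fin n) (𝕜 := ℝ)).toAlgEquiv.toLinearEquiv
  exact L.toContinuousLinearEquiv.toHomeomorph.isInducing.comp Topology.IsInducing.subtypeVal

theorem SO.mul_transpose {n : ℕ} (A : SO n) : A.1 * A.1ᵀ = 1 :=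
  (Matrix.mem_orthogonalGroup_iff _ _).1 A.2.1

theorem SO.transpose_mul {n : ℕ} (A : SO n) : A.1ᵀ * A.1 = 1 :=
  (Matrix.mem_orthogonalGroup_iff' _ _).1 A.2.1

theorem SO.det_eq_one {n : ℕ} (A : SO n) : A.1.det = 1 := A.2.2

theorem SO.coe_inv {n : ℕ} (A : SO n) : (A⁻¹ : SO n).1 = A.1ᵀ := rfl

/-- The element of `SO(n)` given by a matrix with orthonormal columns and determinant one. -/
def SO.mk {n : ℕ} (A : Matrix (Fin n) (Fin n) ℝ) (h : Aᵀ * A = 1) (hd : A.det = 1) : SO n :=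
  ⟨A, (Matrix.mem_orthogonalGroup_iff' _ _).2 h, hd⟩

/-- The skew-symmetric matrix with given entries above the diagonal. -/
noncomputable def skewMatrix (n : ℕ) : SkewModel n →ₗ[ℝ] Matrix (Fin n) (Fin n) ℝ where
  toFun X := Matrix.of fun a b =>
    if h : a < b then X ⟨(a, b), h⟩ else if h : b < a then -X ⟨(b, a), h⟩ else 0
  map_add' X Y := by
    ext a b
    simp only [Matrix.of_apply, Matrix.add_apply, PiLp.add_apply]
    split_ifs <;> ring
  map_smul' c X := by
    ext a b
    simp only [Matrix.of_apply, Matrix.smul_apply, PiLp.smul_apply, smul_eq_mul, RingHom.id_apply]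
    split_ifs <;> ring

/-- The entries above the diagonal. -/
noncomputable def upperEntries (n : ℕ) : Matrix (Fin n) (Fin n) ℝ →ₗ[ℝ] SkewModel n where
  toFun A := WithLp.toLp 2 fun p => A p.1.1 p.1.2
  map_add' _ _ := rfl
  map_smul' _ _ := rfl

theorem skewMatrix_transpose {n : ℕ} (X : SkewModel n) :
    (skewMatrix n X)ᵀ = -skewMatrix n X := by
  ext a b
  simp only [skewMatrix, LinearMap.coe_mk, AddHom.coe_mk, Matrix.transpose_apply,
    Matrix.of_apply, Matrix.neg_apply]
  rcases lt_trichotomy a b with h | h | h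
  · simp [h, h.not_gt]
  · simp [h]
  · simp [h, h.not_gt]

theorem upperEntries_skewMatrix {n : ℕ} (X : SkewModel n) :
    upperEntries n (skewMatrix n X) = X := by
  ext ⟨⟨a, b⟩, h⟩
  exact dif_pos h

theorem skewMatrix_upperEntries {n : ℕ} (S : Matrix (Fin n) (Fin n) ℝ) (hS : Sᵀ = -S) :
    skewMatrix n (upperEntries n S) = S := by
  have hS' : ∀ a b, S b a = -S a b := fun a b => congrFun (congrFun hS a) b
  ext a b
  change (if h : a < b then S a b else if h : b < a then -S b a else 0) = S a b
  rcases lt_trichotomy a b with h | h | h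
  · simp [h]
  · subst h
    have := hS' a a
    simp; linarith
  · simp [h, h.not_gt, hS' b a]

theorem isUnit_one_add_of_skew {n : ℕ} {S : Matrix (Fin n) (Fin n) ℝ} (hS : Sᵀ = -S) :
    IsUnit (1 + S) := by
  rw [← Matrix.mulVec_injective_iff_isUnit]
  rw [← Matrix.coe_mulVecLin, ← LinearMap.ker_eq_bot, LinearMap.ker_eq_bot']
  intro x hx
  have hx : (1 + S) *ᵥ x = 0 := hx
  have h1 : x ⬝ᵥ (S *ᵥ x) = -(x ⬝ᵥ (S *ᵥ x)) := by
    conv_lhs => rw [Matrix.dotProduct_mulVec, ← Matrix.mulVec_transpose, hS, dotProduct_comm,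
      Matrix.neg_mulVec, dotProduct_neg]
  have h2 : x ⬝ᵥ ((1 + S) *ᵥ x) = x ⬝ᵥ x := by
    rw [Matrix.add_mulVec, Matrix.one_mulVec, dotProduct_add]; linarith
  rw [hx, dotProduct_zero] at h2
  exact dotProduct_self_eq_zero.1 h2.symm

/-- The Cayley transform. -/
noncomputable def cayley {n : ℕ} (S : Matrix (Fin n) (Fin n) ℝ) : Matrix (Fin n) (Fin n) ℝ :=
  (1 - S) * (1 + S)⁻¹

theorem cayley_cayley {n : ℕ} {S : Matrix (Fin n) (Fin n) ℝ} (h : IsUnit (1 + S)) :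
    IsUnit (1 + cayley S) ∧ cayley (cayley S) = S := by
  have hd := (Matrix.isUnit_iff_isUnit_det _).1 h
  have h1 : 1 + cayley S = (2 : ℝ) • (1 + S)⁻¹ := by
    have : (1 + S) * (1 + S)⁻¹ = 1 := Matrix.mul_nonsing_inv _ hd
    calc 1 + cayley S = (1 + S) * (1 + S)⁻¹ + (1 - S) * (1 + S)⁻¹ := by rw [this, cayley]
      _ = ((2 : ℝ) • (1 : Matrix _ _ ℝ)) * (1 + S)⁻¹ := by
        rw [← add_mul, two_smul]; congr 1; abel
      _ = _ := by rw [smul_mul_assoc, one_mul]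
  have h2 : 1 - cayley S = (2 : ℝ) • (S * (1 + S)⁻¹) := by
    have : (1 + S) * (1 + S)⁻¹ = 1 := Matrix.mul_nonsing_inv _ hd
    calc 1 - cayley S = (1 + S) * (1 + S)⁻¹ - (1 - S) * (1 + S)⁻¹ := by rw [this, cayley]
      _ = ((2 : ℝ) • S) * (1 + S)⁻¹ := by
        rw [← sub_mul, two_smul]; congr 1; abel
      _ = _ := by rw [smul_mul_assoc]
  have h3 : ((1 : Matrix (Fin n) (Fin n) ℝ) + cayley S) * ((2 : ℝ)⁻¹ • (1 + S)) = 1 := by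
    rw [h1, smul_mul_smul_comm, Matrix.nonsing_inv_mul _ hd]; norm_num
  refine ⟨(Matrix.isUnit_iff_isUnit_det _).2 (Matrix.isUnit_det_of_right_inverse h3), ?_⟩
  rw [cayley, Matrix.inv_eq_right_inv h3, h2, smul_mul_smul_comm, mul_assoc,
    Matrix.nonsing_inv_mul _ hd]
  norm_num

theorem cayley_orthogonal {n : ℕ} {S : Matrix (Fin n) (Fin n) ℝ} (hS : Sᵀ = -S) :
    (cayley S)ᵀ * cayley S = 1 ∧ (cayley S).det = 1 := by
  have hu := (Matrix.isUnit_iff_isUnit_det _).1 (isUnit_one_add_of_skew hS)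
  have hT : (1 + S)ᵀ = 1 - S := by rw [Matrix.transpose_add, hS, Matrix.transpose_one]; abel
  have hT' : (1 - S)ᵀ = 1 + S := by rw [Matrix.transpose_sub, hS, Matrix.transpose_one]; abel
  have hu' : IsUnit (1 - S).det := by rw [← hT, Matrix.det_transpose]; exact hu
  constructor
  · rw [cayley, Matrix.transpose_mul, Matrix.transpose_nonsing_inv, hT, hT']
    have hc : (1 + S) * (1 - S) = (1 - S) * (1 + S) := by noncomm_ring
    calc (1 - S)⁻¹ * (1 + S) * ((1 - S) * (1 + S)⁻¹)
        = (1 - S)⁻¹ * ((1 + S) * (1 - S)) * (1 + S)⁻¹ := by simp only [mul_assoc]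
      _ = ((1 - S)⁻¹ * (1 - S)) * ((1 + S) * (1 + S)⁻¹) := by rw [hc]; simp only [mul_assoc]
      _ = 1 := by rw [Matrix.nonsing_inv_mul _ hu', Matrix.mul_nonsing_inv _ hu, one_mul]
  · rw [cayley, Matrix.det_mul, ← hT, Matrix.det_transpose, ← Matrix.det_mul,
      Matrix.mul_nonsing_inv _ hu, Matrix.det_one]

theorem cayley_skew {n : ℕ} {A : Matrix (Fin n) (Fin n) ℝ} (hA : Aᵀ * A = 1)
    (h : IsUnit (1 + A)) : (cayley A)ᵀ = -cayley A := by
  have hu := (Matrix.isUnit_iff_isUnit_det _).1 h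
  have hu' : IsUnit (1 + Aᵀ).det := by
    rw [← Matrix.det_transpose]; simpa using hu
  have hA' : A * Aᵀ = 1 := mul_eq_one_comm.1 hA
  have hc : (1 - Aᵀ) * (1 + A) = -((1 + Aᵀ) * (1 - A)) := by
    have e1 : (1 - Aᵀ) * (1 + A) = 1 + A - Aᵀ - Aᵀ * A := by noncomm_ring
    have e2 : (1 + Aᵀ) * (1 - A) = 1 - A + Aᵀ - Aᵀ * A := by noncomm_ring
    rw [e1, e2, hA]; abel
  rw [cayley, Matrix.transpose_mul, Matrix.transpose_nonsing_inv, Matrix.transpose_add,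
    Matrix.transpose_sub, Matrix.transpose_one]
  calc (1 + Aᵀ)⁻¹ * (1 - Aᵀ)
      = (1 + Aᵀ)⁻¹ * ((1 - Aᵀ) * (1 + A)) * (1 + A)⁻¹ := by
        rw [mul_assoc, mul_assoc, Matrix.mul_nonsing_inv _ hu, mul_one]
    _ = -(((1 + Aᵀ)⁻¹ * (1 + Aᵀ)) * ((1 - A) * (1 + A)⁻¹)) := by
        rw [hc]; simp only [mul_assoc, neg_mul, mul_neg]
    _ = -((1 - A) * (1 + A)⁻¹) := by rw [Matrix.nonsing_inv_mul _ hu', one_mul]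

theorem SO.exists_chart {n : ℕ} (g : SO n) :
    ∃ e : OpenPartialHomeomorph (SO n) (SkewModel n),
      IsSubmanifoldChart SO.toEnd e ∧ g ∈ e.source := by
  let L := Matrix.toEuclideanCLM (n := Fin n) (𝕜 := ℝ)
  let U : Set (Eucl n →L[ℝ] Eucl n) := {T | IsUnit (1 + L g.1ᵀ * T)}
  have hU : IsOpen U := Units.isOpen.preimage (by fun_prop)
  let C : (Eucl n →L[ℝ] Eucl n) →ₗ[ℝ] SkewModel n :=
    upperEntries n ∘ₗ L.symm.toAlgEquiv.toLinearEquiv.toLinearMap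
  let D : SkewModel n →ₗ[ℝ] (Eucl n →L[ℝ] Eucl n) :=
    L.toAlgEquiv.toLinearEquiv.toLinearMap ∘ₗ skewMatrix n
  have hC : ContDiff ℝ ∞ C := C.toContinuousLinearMap.contDiff
  have hD : ContDiff ℝ ∞ D := D.toContinuousLinearMap.contDiff
  have hL : ∀ A, IsUnit (L A) ↔ IsUnit A := fun A => MulEquiv.isUnit_map (f := L)
  have hLinv : ∀ A, IsUnit A → Ring.inverse (L A) = L A⁻¹ := by
    intro A hA
    have hd := (Matrix.isUnit_iff_isUnit_det _).1 hA
    have h1 : L A * L A⁻¹ = 1 := by rw [← map_mul, Matrix.mul_nonsing_inv _ hd, map_one]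
    exact ((Ring.inverse_mul_eq_iff_eq_mul _ _ _ ((hL A).2 hA)).2 h1.symm ▸
      (mul_one _).symm : Ring.inverse (L A) = L A⁻¹)
  let φ : (Eucl n →L[ℝ] Eucl n) → SkewModel n := fun T =>
    C ((1 - L g.1ᵀ * T) * Ring.inverse (1 + L g.1ᵀ * T))
  have hφ : ContDiffOn ℝ ∞ φ U := by
    intro T hT
    have h1 : ContDiff ℝ ∞ fun T : Eucl n →L[ℝ] Eucl n => L g.1ᵀ * T :=
      contDiff_const.mul contDiff_id
    refine (hC.contDiffAt.comp T
      ((contDiff_const.sub h1).contDiffAt.mul ?_)).contDiffWithinAt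
    obtain ⟨u, hu⟩ := (hT : IsUnit (1 + L g.1ᵀ * T))
    refine ContDiffAt.comp (g := Ring.inverse) T ?_ (contDiff_const.add h1).contDiffAt
    rw [← hu]
    exact contDiffAt_ringInverse ℝ u
  let ψ : SkewModel n → SO n := fun X => g *
    SO.mk (cayley (skewMatrix n X)) (cayley_orthogonal (skewMatrix_transpose X)).1
      (cayley_orthogonal (skewMatrix_transpose X)).2
  have hψ1 : ∀ X, (SO.toEnd (ψ X)) = L g.1 * L (cayley (skewMatrix n X)) := fun X =>
    map_mul L _ _
  have hφ1 : ∀ A : SO n, IsUnit (1 + g.1ᵀ * A.1) →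
      φ (SO.toEnd A) = upperEntries n (cayley (g.1ᵀ * A.1)) := by
    intro A hA
    have e1 : (1 : Eucl n →L[ℝ] Eucl n) + L g.1ᵀ * SO.toEnd A = L (1 + g.1ᵀ * A.1) := by
      rw [map_add, map_one, map_mul]; rfl
    have e2 : (1 : Eucl n →L[ℝ] Eucl n) - L g.1ᵀ * SO.toEnd A = L (1 - g.1ᵀ * A.1) := by
      rw [map_sub, map_one, map_mul]; rfl
    simp only [φ, e1, e2, hLinv _ hA, ← map_mul]
    change upperEntries n (L.symm (L _)) = _
    rw [StarAlgEquiv.symm_apply_apply]; rfl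
  have hUiff : ∀ A : SO n, SO.toEnd A ∈ U ↔ IsUnit (1 + g.1ᵀ * A.1) := by
    intro A
    have e1 : (1 : Eucl n →L[ℝ] Eucl n) + L g.1ᵀ * SO.toEnd A = L (1 + g.1ᵀ * A.1) := by
      rw [map_add, map_one, map_mul]; rfl
    rw [← hL, ← e1]; rfl
  have hgψ : ∀ X, g.1ᵀ * (ψ X).1 = cayley (skewMatrix n X) := by
    intro X
    change g.1ᵀ * (g.1 * cayley (skewMatrix n X)) = _
    rw [← mul_assoc, SO.transpose_mul, one_mul]
  have hcc := fun X : SkewModel n =>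
    cayley_cayley (isUnit_one_add_of_skew (skewMatrix_transpose X))
  obtain ⟨e, he, hs⟩ := exists_isSubmanifoldChart (SO.isInducing_toEnd n) hU hφ (ψ := ψ)
    (by
      have : SO.toEnd ∘ ψ = fun X => L g.1 * ((1 - D X) * Ring.inverse (1 + D X)) := by
        funext X
        have hu := isUnit_one_add_of_skew (skewMatrix_transpose X)
        have e1 : (1 : Eucl n →L[ℝ] Eucl n) + D X = L (1 + skewMatrix n X) := by
          rw [map_add, map_one]; rfl
        have e2 : (1 : Eucl n →L[ℝ] Eucl n) - D X = L (1 - skewMatrix n X) := by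
          rw [map_sub, map_one]; rfl
        rw [Function.comp_apply, hψ1, e1, e2, hLinv _ hu, ← map_mul L (1 - _)]; rfl
      rw [this]
      refine contDiff_const.mul ((contDiff_const.sub hD).mul ?_)
      rw [contDiff_iff_contDiffAt]
      intro X
      obtain ⟨u, hu⟩ : IsUnit (1 + D X) := by
        have := (hL _).2 (isUnit_one_add_of_skew (skewMatrix_transpose X))
        rwa [map_add, map_one] at this
      refine ContDiffAt.comp (g := Ring.inverse) X ?_ (contDiff_const.add hD).contDiffAt
      rw [← hu]
      exact contDiffAt_ringInverse ℝ u)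
    (by
      intro X
      rw [hUiff, hgψ]
      exact (hcc X).1)
    (by
      intro X
      rw [hφ1 _ (by rw [hgψ]; exact (hcc X).1), hgψ, (hcc X).2, upperEntries_skewMatrix])
    (by
      intro A hA
      rw [hUiff] at hA
      have ho : (g.1ᵀ * A.1)ᵀ * (g.1ᵀ * A.1) = 1 := by
        rw [Matrix.transpose_mul, Matrix.transpose_transpose, mul_assoc, ← mul_assoc g.1,
          SO.mul_transpose, one_mul, SO.transpose_mul]
      rw [hφ1 _ hA]
      apply Subtype.ext
      change g.1 * cayley (skewMatrix n _) = _
      rw [skewMatrix_upperEntries _ (cayley_skew ho hA), (cayley_cayley hA).2, ← mul_assoc,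
        SO.mul_transpose, one_mul])
  refine ⟨e, he, ?_⟩
  rw [hs, Set.mem_preimage, hUiff, SO.transpose_mul]
  have : (1 : Matrix (Fin n) (Fin n) ℝ) + 1 = (2 : ℝ) • 1 := by rw [two_smul]
  rw [this]
  refine (Matrix.isUnit_iff_isUnit_det _).2 (IsUnit.mk0 _ ?_)
  rw [Matrix.det_smul, Matrix.det_one, mul_one]
  exact pow_ne_zero _ two_ne_zero

/-- `SO(n)` as an embedded submanifold of the space of `n × n` matrices. -/
noncomputable instance SO.instChartedSpace (n : ℕ) : ChartedSpace (SkewModel n) (SO n) :=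
  submanifoldChartedSpace SO.toEnd SO.exists_chart

instance SO.instIsManifold (n : ℕ) : IsManifold 𝓘(ℝ, SkewModel n) ∞ (SO n) :=
  IsSubmanifoldChart.isManifold (ι := SO.toEnd) fun _ h => h

theorem SO.contMDiff_toEnd (n : ℕ) :
    ContMDiff 𝓘(ℝ, SkewModel n) 𝓘(ℝ, Eucl n →L[ℝ] Eucl n) ∞ (SO.toEnd (n := n)) :=
  IsSubmanifoldChart.contMDiff_embedding (SO.isInducing_toEnd n).continuous fun _ h => h

end SpecialOrthogonal

/-! ### Frames of flags -/

section Frames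

/-- The index `j` of the block `n_j ≤ a < n_{j+1}` that contains `a`, where the block sizes are
given by `n_0 = 0 < n_1 < ⋯ < n_d < n = n_{d+1}`. The matrix indices and the entries of `k` are
counted from zero, so `k i` stands for `n_{i+1}`. -/
def blockIndex {d n : ℕ} (k : Fin d → ℕ) (a : Fin n) : Fin (d + 1) :=
  ⟨(Finset.univ.filter fun i => k i ≤ (a : ℕ)).card,
    Nat.lt_succ_of_le ((Finset.card_le_univ _).trans_eq (Fintype.card_fin d))⟩

/-- The coordinate space whose dimension is that of the flag manifold: matrix entries strictly
below the diagonal blocks. -/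
abbrev CellModel {d : ℕ} (k : Fin d → ℕ) (n : ℕ) : Type :=
  EuclideanSpace ℝ {p : Fin n × Fin n // blockIndex k p.2 < blockIndex k p.1}

/-- The span of the first `m` vectors of a family. -/
def prefixSpan {n : ℕ} (m : ℕ) (u : Fin n → Eucl n) : Submodule ℝ (Eucl n) :=
  Submodule.span ℝ (u '' {b | (b : ℕ) < m})

variable {d n : ℕ} {k : Fin d → ℕ}

theorem blockIndex_mono {a b : Fin n} (h : a ≤ b) : blockIndex k a ≤ blockIndex k b := by
  refine Fin.mk_le_mk.2 (Finset.card_le_card fun i hi => ?_)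
  have : (a : ℕ) ≤ b := h
  simp only [Finset.mem_filter, Finset.mem_univ, true_and] at hi ⊢
  omega

theorem lt_of_blockIndex_lt {a b : Fin n} (h : blockIndex k b < blockIndex k a) : b < a := by
  by_contra hab
  exact absurd (blockIndex_mono (k := k) (not_lt.1 hab)) (not_le.2 h)

theorem exists_of_blockIndex_lt {a b : Fin n} (h : blockIndex k b < blockIndex k a) :
    ∃ i, (b : ℕ) < k i ∧ k i ≤ (a : ℕ) := by
  by_contra hcon
  push Not at hcon
  refine absurd h (not_lt.2 (Fin.mk_le_mk.2 (Finset.card_le_card fun i hi => ?_)))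
  simp only [Finset.mem_filter, Finset.mem_univ, true_and] at hi ⊢
  by_contra h'
  have := hcon i (not_le.1 h')
  omega

theorem blockIndex_lt_of {a b : Fin n} {i : Fin d} (hb : (b : ℕ) < k i) (ha : k i ≤ (a : ℕ)) :
    blockIndex k b < blockIndex k a := by
  refine Fin.mk_lt_mk.2 (Finset.card_lt_card ⟨fun j hj => ?_, fun hsub => ?_⟩)
  · simp only [Finset.mem_filter, Finset.mem_univ, true_and] at hj ⊢
    omega
  · have : i ∈ Finset.univ.filter fun i => k i ≤ (b : ℕ) := hsub (by simpa using ha)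
    simp only [Finset.mem_filter, Finset.mem_univ, true_and] at this
    omega

theorem exists_next (b : Fin n) (h : ∃ i, (b : ℕ) < k i) :
    ∃ i, (b : ℕ) < k i ∧ ∀ j, (b : ℕ) < k j → k i ≤ k j := by
  obtain ⟨i0, h0⟩ := h
  obtain ⟨i, hi, hmin⟩ := (Finset.univ.filter fun i => (b : ℕ) < k i).exists_min_image k
    ⟨i0, by simpa using h0⟩
  exact ⟨i, by simpa using hi, fun j hj => hmin j (by simpa using hj)⟩

/-- The index of the smallest `k i` exceeding `b`. -/
noncomputable def nextIndex (k : Fin d → ℕ) (b : Fin n) (h : ∃ i, (b : ℕ) < k i) : Fin d :=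
  (exists_next b h).choose

theorem lt_nextIndex (b : Fin n) (h : ∃ i, (b : ℕ) < k i) : (b : ℕ) < k (nextIndex k b h) :=
  (exists_next b h).choose_spec.1

theorem nextIndex_le (b : Fin n) (h : ∃ i, (b : ℕ) < k i) {j : Fin d} (hj : (b : ℕ) < k j) :
    k (nextIndex k b h) ≤ k j :=
  (exists_next b h).choose_spec.2 j hj

theorem exists_lt_of_pos (p : {p : Fin n × Fin n // blockIndex k p.2 < blockIndex k p.1}) :
    ∃ i, (p.1.2 : ℕ) < k i :=
  let ⟨i, hi, _⟩ := exists_of_blockIndex_lt p.2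
  ⟨i, hi⟩

/-- The matrix with given entries below the diagonal blocks and zeros elsewhere. -/
noncomputable def cellEntry (X : CellModel k n) (a b : Fin n) : ℝ :=
  if h : blockIndex k b < blockIndex k a then X ⟨(a, b), h⟩ else 0

/-- The frame obtained from `v` by a block unipotent lower triangular change of basis. -/
noncomputable def cellFrame (v : Fin n → Eucl n) (X : CellModel k n) (b : Fin n) : Eucl n :=
  v b + ∑ a, cellEntry X a b • v a

theorem inner_cellFrame {v : Fin n → Eucl n} (hv : Orthonormal ℝ v) (X : CellModel k n)
    (a b : Fin n) :
    inner ℝ (v a) (cellFrame v X b) = (if a = b then 1 else 0) + cellEntry X a b := by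
  rw [cellFrame, inner_add_right, hv.inner_right_fintype, orthonormal_iff_ite.1 hv]

theorem cellFrame_triangular {v : Fin n → Eucl n} (hv : Orthonormal ℝ v) (X : CellModel k n)
    (m : ℕ) (c : Fin n → ℝ) (hc : ∀ b : Fin n, m ≤ (b : ℕ) → c b = 0)
    (h : ∀ a : Fin n, (a : ℕ) < m → inner ℝ (v a) (∑ b, c b • cellFrame v X b) = 0) : c = 0 := by
  have key : ∀ N : ℕ, ∀ a : Fin n, (a : ℕ) < N → c a = 0 := by
    intro N
    induction N with
    | zero => intro a ha; omega
    | succ N ih =>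
      intro a ha
      by_cases ham : m ≤ (a : ℕ)
      · exact hc a ham
      have h1 := h a (not_le.1 ham)
      have h2 : ∀ b, c b * cellEntry X a b = 0 := by
        intro b
        by_cases hb : blockIndex k b < blockIndex k a
        · have : (b : ℕ) < a := lt_of_blockIndex_lt hb
          rw [ih b (by omega), zero_mul]
        · rw [cellEntry, dif_neg hb, mul_zero]
      simpa [inner_sum, inner_smul_right, inner_cellFrame hv, mul_add, Finset.sum_add_distrib, h2]
        using h1
  funext a
  exact key n a a.2

theorem cellFrame_linearIndependent {v : Fin n → Eucl n} (hv : Orthonormal ℝ v)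
    (X : CellModel k n) : LinearIndependent ℝ (cellFrame v X) := by
  rw [Fintype.linearIndependent_iff]
  intro c hc i
  have := cellFrame_triangular hv X n c (fun b hb => absurd b.2 (not_lt.2 hb))
    (fun a _ => by rw [hc, inner_zero_right])
  rw [this]; rfl

theorem mem_prefixSpan {u : Fin n → Eucl n} {m : ℕ} {x : Eucl n} :
    x ∈ prefixSpan m u ↔
      ∃ c : Fin n → ℝ, (∀ b : Fin n, m ≤ (b : ℕ) → c b = 0) ∧ ∑ b, c b • u b = x := by
  constructor
  · intro hx
    induction hx using Submodule.span_induction with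
    | mem x hx =>
      obtain ⟨b, hb, rfl⟩ := hx
      refine ⟨Pi.single b 1, fun a ha => ?_, ?_⟩
      · have hb' : (b : ℕ) < m := hb
        exact Pi.single_eq_of_ne (by rintro rfl; omega) _
      · simp [Pi.single_apply]
    | zero => exact ⟨0, by simp, by simp⟩
    | add x y _ _ hx hy =>
      obtain ⟨c, hc, rfl⟩ := hx
      obtain ⟨c', hc', rfl⟩ := hy
      exact ⟨c + c', fun b hb => by simp [hc b hb, hc' b hb],
        by simp [add_smul, Finset.sum_add_distrib]⟩
    | smul r x _ hx =>
      obtain ⟨c, hc, rfl⟩ := hx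
      exact ⟨r • c, fun b hb => by simp [hc b hb], by simp [Finset.smul_sum, mul_smul]⟩
  · rintro ⟨c, hc, rfl⟩
    refine Submodule.sum_mem _ fun b _ => ?_
    by_cases hb : (b : ℕ) < m
    · exact Submodule.smul_mem _ _ (Submodule.subset_span ⟨b, hb, rfl⟩)
    · rw [hc b (not_lt.1 hb), zero_smul]; exact Submodule.zero_mem _

theorem self_mem_prefixSpan {u : Fin n → Eucl n} {m : ℕ} {b : Fin n} (hb : (b : ℕ) < m) :
    u b ∈ prefixSpan m u :=
  Submodule.subset_span ⟨b, hb, rfl⟩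

theorem prefixSpan_le_iff {u : Fin n → Eucl n} {m : ℕ} {V : Submodule ℝ (Eucl n)} :
    prefixSpan m u ≤ V ↔ ∀ b : Fin n, (b : ℕ) < m → u b ∈ V :=
  ⟨fun h _ hb => h (self_mem_prefixSpan hb), fun h => Submodule.span_le.2 (by
    rintro _ ⟨b, hb, rfl⟩; exact h b hb)⟩

theorem finrank_prefixSpan {u : Fin n → Eucl n} (hu : LinearIndependent ℝ u) (m : ℕ) :
    Module.finrank ℝ (prefixSpan m u) = Fintype.card {b : Fin n // (b : ℕ) < m} := by
  have h := finrank_span_eq_card (hu.comp (fun b : {b : Fin n // (b : ℕ) < m} => b.1)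
    Subtype.val_injective)
  have hr : u '' {b | (b : ℕ) < m} =
      Set.range (u ∘ fun b : {b : Fin n // (b : ℕ) < m} => b.1) := by
    ext x
    simp [Set.mem_image]
  rw [← h, prefixSpan, hr]

/-- The orthogonal projection onto the span of a part of an orthonormal family. -/
theorem starProjection_prefixSpan {w : Fin n → Eucl n} (hw : Orthonormal ℝ w) (m : ℕ) :
    (prefixSpan m w).starProjection =
      ∑ b : Fin n, if (b : ℕ) < m then (innerSL ℝ (w b)).smulRight (w b) else 0 := by
  ext1 x
  refine (Submodule.eq_starProjection_of_mem_of_inner_eq_zero ?_ ?_)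
  · rw [_root_.sum_apply]
    refine Submodule.sum_mem _ fun b _ => ?_
    split_ifs with hb
    · exact Submodule.smul_mem _ _ (self_mem_prefixSpan hb)
    · exact Submodule.zero_mem _
  · intro y hy
    obtain ⟨c, hc, rfl⟩ := mem_prefixSpan.1 hy
    rw [inner_sum]
    refine Finset.sum_eq_zero fun b _ => ?_
    rw [inner_smul_right]
    by_cases hb : (b : ℕ) < m
    · rw [inner_sub_left, _root_.sum_apply, sum_inner, Finset.sum_eq_single b]
      · simp [hb, inner_smul_left, real_inner_comm, hw.1 b]
      · intro a _ hab
        split_ifs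
        · simp [inner_smul_left, hw.2 hab]
        · simp
      · simp
    · rw [hc b (not_lt.1 hb), zero_mul]

theorem contDiff_gramSchmidt {G : Type*} [NormedAddCommGroup G] [NormedSpace ℝ G]
    {u : G → Fin n → Eucl n} (hu : ∀ b, ContDiff ℝ ∞ fun x => u x b)
    (hli : ∀ x, LinearIndependent ℝ (u x)) (b : Fin n) :
    ContDiff ℝ ∞ fun x => gramSchmidt ℝ (u x) b := by
  induction b using WellFoundedLT.induction with
  | ind b ih =>
    have : (fun x => gramSchmidt ℝ (u x) b) = fun x => u x b - ∑ i ∈ Finset.Iio b,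
        (inner ℝ (gramSchmidt ℝ (u x) i) (u x b) / ‖gramSchmidt ℝ (u x) i‖ ^ 2) •
          gramSchmidt ℝ (u x) i := by
      funext x
      have h := gramSchmidt_def'' ℝ (u x) b
      exact eq_sub_of_add_eq h.symm
    rw [this]
    refine (hu b).sub (ContDiff.sum fun i hi => ?_)
    have hi' := ih i (Finset.mem_Iio.1 hi)
    refine ContDiff.smul (ContDiff.div (hi'.inner ℝ (hu b)) (hi'.norm_sq ℝ) fun x => ?_) hi'
    exact pow_ne_zero _ (norm_ne_zero_iff.2 (gramSchmidt_ne_zero i (hli x)))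

theorem contDiff_gramSchmidtNormed {G : Type*} [NormedAddCommGroup G] [NormedSpace ℝ G]
    {u : G → Fin n → Eucl n} (hu : ∀ b, ContDiff ℝ ∞ fun x => u x b)
    (hli : ∀ x, LinearIndependent ℝ (u x)) (b : Fin n) :
    ContDiff ℝ ∞ fun x => gramSchmidtNormed ℝ (u x) b := by
  have h := contDiff_gramSchmidt hu hli b
  have h0 : ∀ x, gramSchmidt ℝ (u x) b ≠ 0 := fun x => gramSchmidt_ne_zero b (hli x)
  exact ((h.norm ℝ h0).inv fun x => norm_ne_zero_iff.2 (h0 x)).smul h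

theorem prefixSpan_gramSchmidtNormed (u : Fin n → Eucl n) (m : ℕ) :
    prefixSpan m (gramSchmidtNormed ℝ u) = prefixSpan m u := by
  rw [prefixSpan, span_gramSchmidtNormed]
  refine le_antisymm (Submodule.span_le.2 ?_) (Submodule.span_le.2 ?_)
  · rintro _ ⟨b, hb, rfl⟩
    refine Submodule.span_mono (Set.image_mono ?_) (gramSchmidt_mem_span ℝ u (le_refl b))
    intro a ha
    have h1 : (a : ℕ) ≤ b := ha
    have h2 : (b : ℕ) < m := hb
    exact lt_of_le_of_lt h1 h2
  · rintro _ ⟨b, hb, rfl⟩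
    refine Submodule.span_mono (Set.image_mono ?_) (mem_span_gramSchmidt ℝ u (le_refl b))
    intro a ha
    have h1 : (a : ℕ) ≤ b := ha
    have h2 : (b : ℕ) < m := hb
    exact lt_of_le_of_lt h1 h2

theorem contDiff_cellFrame (v : Fin n → Eucl n) (b : Fin n) :
    ContDiff ℝ ∞ fun X : CellModel k n => cellFrame v X b := by
  refine contDiff_const.add (ContDiff.sum fun a _ =>
    ContDiff.smul (f := fun X : CellModel k n => cellEntry X a b) (g := fun _ => v a)
      ?_ contDiff_const)
  unfold cellEntry
  split_ifs with h
  · exact (EuclideanSpace.proj (𝕜 := ℝ) (⟨(a, b), h⟩ :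
      {p : Fin n × Fin n // blockIndex k p.2 < blockIndex k p.1})).contDiff
  · exact contDiff_const

/-- The orthonormal frame adapted to the flag of `cellFrame`. -/
noncomputable def orthoFrame (v : Fin n → Eucl n) (X : CellModel k n) : Fin n → Eucl n :=
  gramSchmidtNormed ℝ (cellFrame v X)

theorem orthoFrame_orthonormal {v : Fin n → Eucl n} (hv : Orthonormal ℝ v) (X : CellModel k n) :
    Orthonormal ℝ (orthoFrame v X) :=
  gramSchmidtNormed_orthonormal (cellFrame_linearIndependent hv X)

theorem contDiff_orthoFrame {v : Fin n → Eucl n} (hv : Orthonormal ℝ v) (b : Fin n) :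
    ContDiff ℝ ∞ fun X : CellModel k n => orthoFrame v X b :=
  contDiff_gramSchmidtNormed (contDiff_cellFrame v) (cellFrame_linearIndependent hv) b

theorem contDiff_smulRight_self {G : Type*} [NormedAddCommGroup G] [NormedSpace ℝ G]
    {w : G → Eucl n} (hw : ContDiff ℝ ∞ w) :
    ContDiff ℝ ∞ fun x => (innerSL ℝ (w x)).smulRight (w x) :=
  ((innerSL ℝ).contDiff.comp hw).smulRight hw

theorem contDiff_starProjection_cellFrame {v : Fin n → Eucl n} (hv : Orthonormal ℝ v) (m : ℕ) :
    ContDiff ℝ ∞ fun X : CellModel k n => (prefixSpan m (cellFrame v X)).starProjection := by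
  have : (fun X : CellModel k n => (prefixSpan m (cellFrame v X)).starProjection) = fun X =>
      ∑ b : Fin n, if (b : ℕ) < m then
        (innerSL ℝ (orthoFrame v X b)).smulRight (orthoFrame v X b) else 0 := by
    funext X
    rw [← starProjection_prefixSpan (orthoFrame_orthonormal hv X)]
    congr 1
    exact (prefixSpan_gramSchmidtNormed _ _).symm
  rw [this]
  refine ContDiff.sum fun b _ => ?_
  split_ifs
  · exact contDiff_smulRight_self (contDiff_orthoFrame hv b)
  · exact contDiff_const

/-- The invertibility of this operator expresses that `P` and `E` are the orthogonal projections
onto `V` and `S` with `V` complementary to the orthogonal complement of `S`. -/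
noncomputable def compareOp (P E : Eucl n →L[ℝ] Eucl n) : Eucl n →L[ℝ] Eucl n :=
  E * P + (1 - E) * (1 - P)

/-- The projection onto `V` along the orthogonal complement of `S`. -/
noncomputable def obliqueProj (P E : Eucl n →L[ℝ] Eucl n) : Eucl n →L[ℝ] Eucl n :=
  P * Ring.inverse (compareOp P E) * E

theorem proj_proj (S : Submodule ℝ (Eucl n)) (x : Eucl n) :
    S.starProjection (S.starProjection x) = S.starProjection x :=
  Submodule.starProjection_eq_self_iff.2 (Submodule.starProjection_apply_mem _ _)

theorem compareOp_apply (P E : Eucl n →L[ℝ] Eucl n) (x : Eucl n) :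
    compareOp P E x = E (P x) + ((x - P x) - E (x - P x)) := by
  simp [compareOp]

theorem compareOp_proj (V S : Submodule ℝ (Eucl n)) (x : Eucl n) :
    S.starProjection (compareOp V.starProjection S.starProjection x) =
      S.starProjection (V.starProjection x) := by
  rw [compareOp_apply, map_add, proj_proj, map_sub S.starProjection _ (S.starProjection _),
    proj_proj, sub_self, add_zero]

theorem obliqueProj_mem (V S : Submodule ℝ (Eucl n)) (y : Eucl n) :
    obliqueProj V.starProjection S.starProjection y ∈ V :=
  Submodule.starProjection_apply_mem _ _

theorem proj_obliqueProj {V S : Submodule ℝ (Eucl n)}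
    (h : IsUnit (compareOp V.starProjection S.starProjection)) (y : Eucl n) :
    S.starProjection (obliqueProj V.starProjection S.starProjection y) = S.starProjection y := by
  have h1 : compareOp V.starProjection S.starProjection
      (Ring.inverse (compareOp V.starProjection S.starProjection) (S.starProjection y)) =
        S.starProjection y := by
    rw [← mul_apply_eq_comp, Ring.mul_inverse_cancel _ h]; rfl
  have h2 := compareOp_proj V S
    (Ring.inverse (compareOp V.starProjection S.starProjection) (S.starProjection y))
  rw [h1, proj_proj] at h2
  exact h2.symm

theorem obliqueProj_eq {V S : Submodule ℝ (Eucl n)}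
    (h : IsUnit (compareOp V.starProjection S.starProjection)) {y z : Eucl n} (hz : z ∈ V)
    (hyz : S.starProjection z = S.starProjection y) :
    obliqueProj V.starProjection S.starProjection y = z := by
  have hinj := (ContinuousLinearMap.isUnit_iff_bijective.1 h).1
  rw [← sub_eq_zero]
  apply hinj
  have hm : obliqueProj V.starProjection S.starProjection y - z ∈ V :=
    V.sub_mem (obliqueProj_mem V S y) hz
  rw [map_zero, compareOp_apply, Submodule.starProjection_eq_self_iff.2 hm, map_sub,
    proj_obliqueProj h, hyz]
  simp

theorem isUnit_compareOp {V S : Submodule ℝ (Eucl n)}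
    (hfr : Module.finrank ℝ V = Module.finrank ℝ S) (hd : Disjoint V Sᗮ) :
    IsUnit (compareOp V.starProjection S.starProjection) := by
  rw [ContinuousLinearMap.isUnit_iff_bijective]
  have htop : V ⊔ Sᗮ = ⊤ := by
    refine Submodule.eq_top_of_disjoint V Sᗮ ?_ hd
    have := S.finrank_add_finrank_orthogonal
    omega
  have hinj : Function.Injective (compareOp V.starProjection S.starProjection) := by
    rw [injective_iff_map_eq_zero]
    intro x hx
    have h1 := compareOp_proj V S x
    rw [hx, map_zero] at h1
    have h2 : V.starProjection x = 0 := by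
      refine Submodule.disjoint_def.1 hd _ (Submodule.starProjection_apply_mem _ _) ?_
      exact (Submodule.starProjection_apply_eq_zero_iff _).1 h1.symm
    rw [compareOp_apply, h2, map_zero, zero_add, sub_zero, sub_eq_zero] at hx
    have h3 : x ∈ S := Submodule.starProjection_eq_self_iff.1 hx.symm
    have h4 : x ∈ Vᗮ := (Submodule.starProjection_apply_eq_zero_iff _).1 h2
    have h5 : x ∈ (V ⊔ Sᗮ)ᗮ := by
      rw [← Submodule.inf_orthogonal, Submodule.orthogonal_orthogonal]
      exact ⟨h4, h3⟩
    rwa [htop, Submodule.top_orthogonal_eq_bot, Submodule.mem_bot] at h5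
  exact ⟨hinj, (LinearMap.injective_iff_surjective
    (f := (compareOp V.starProjection S.starProjection : Eucl n →ₗ[ℝ] Eucl n))).1 hinj⟩

theorem mem_prefixSpan_orthogonal {v : Fin n → Eucl n} {m : ℕ} {x : Eucl n} :
    x ∈ (prefixSpan m v)ᗮ ↔ ∀ a : Fin n, (a : ℕ) < m → inner ℝ (v a) x = 0 := by
  constructor
  · intro h a ha
    exact h _ (self_mem_prefixSpan ha)
  · intro h y hy
    obtain ⟨c, hc, rfl⟩ := mem_prefixSpan.1 hy
    rw [sum_inner]
    refine Finset.sum_eq_zero fun b _ => ?_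
    rw [inner_smul_left]
    by_cases hb : (b : ℕ) < m
    · rw [h b hb, mul_zero]
    · rw [hc b (not_lt.1 hb)]; simp

theorem isUnit_compareOp_cellFrame {v : Fin n → Eucl n} (hv : Orthonormal ℝ v)
    (X : CellModel k n) (m : ℕ) :
    IsUnit (compareOp (prefixSpan m (cellFrame v X)).starProjection
      (prefixSpan m v).starProjection) := by
  refine isUnit_compareOp ?_ ?_
  · rw [finrank_prefixSpan (cellFrame_linearIndependent hv X),
      finrank_prefixSpan hv.linearIndependent]
  · rw [Submodule.disjoint_def]
    intro x hx hx'
    obtain ⟨c, hc, rfl⟩ := mem_prefixSpan.1 hx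
    rw [cellFrame_triangular hv X m c hc (mem_prefixSpan_orthogonal.1 hx')]
    simp

/-- The coordinates of a flag given by its orthogonal projections `P`, relative to `v`. -/
noncomputable def cellCoord (k : Fin d → ℕ) (v : Fin n → Eucl n)
    (P : Fin d → Eucl n →L[ℝ] Eucl n) : CellModel k n :=
  WithLp.toLp 2 fun p =>
    inner ℝ (v p.1.1) (obliqueProj (P (nextIndex k p.1.2 (exists_lt_of_pos p)))
      (prefixSpan (k (nextIndex k p.1.2 (exists_lt_of_pos p))) v).starProjection (v p.1.2))

/-- The open cell of flags transversal to the flag opposite to that of `v`. -/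
def cellSet (k : Fin d → ℕ) (v : Fin n → Eucl n) : Set (Fin d → Eucl n →L[ℝ] Eucl n) :=
  {P | ∀ i, IsUnit (compareOp (P i) (prefixSpan (k i) v).starProjection)}

theorem contDiff_compareOp (E : Eucl n →L[ℝ] Eucl n) :
    ContDiff ℝ ∞ fun P : Eucl n →L[ℝ] Eucl n => compareOp P E :=
  (contDiff_const.mul contDiff_id).add (contDiff_const.mul (contDiff_const.sub contDiff_id))

theorem isOpen_cellSet (k : Fin d → ℕ) (v : Fin n → Eucl n) : IsOpen (cellSet k v) := by
  have : cellSet k v = ⋂ i, {P | IsUnit (compareOp (P i) (prefixSpan (k i) v).starProjection)} := by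
    ext; simp [cellSet]
  rw [this]
  exact isOpen_iInter_of_finite fun i => Units.isOpen.preimage
    ((contDiff_compareOp _).continuous.comp (continuous_apply i))

theorem contDiffOn_cellCoord (k : Fin d → ℕ) (v : Fin n → Eucl n) :
    ContDiffOn ℝ ∞ (cellCoord k v) (cellSet k v) := by
  intro P hP
  refine ContDiffAt.contDiffWithinAt ?_
  rw [contDiffAt_euclidean]
  intro p
  have h : ∀ (i : Fin d) (E : Eucl n →L[ℝ] Eucl n), IsUnit (compareOp (P i) E) →
      ContDiffAt ℝ ∞ (fun P : Fin d → Eucl n →L[ℝ] Eucl n => obliqueProj (P i) E) P := by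
    intro i E hE
    have h1 : ContDiffAt ℝ ∞ (fun P : Fin d → Eucl n →L[ℝ] Eucl n => P i) P :=
      (contDiff_apply ℝ _ i).contDiffAt
    obtain ⟨u, hu⟩ := hE
    refine (h1.mul (ContDiffAt.comp (g := Ring.inverse) P ?_
      ((contDiff_compareOp E).contDiffAt.comp P h1))).mul contDiffAt_const
    rw [Function.comp_apply, ← hu]
    exact contDiffAt_ringInverse ℝ u
  exact contDiffAt_const.inner ℝ (ContDiffAt.clm_apply (h _ _ (hP _)) contDiffAt_const)

theorem starProjection_prefixSpan_of_orthonormal {v : Fin n → Eucl n} (hv : Orthonormal ℝ v)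
    (m : ℕ) (x : Eucl n) :
    (prefixSpan m v).starProjection x =
      ∑ b : Fin n, if (b : ℕ) < m then inner ℝ (v b) x • v b else 0 := by
  rw [starProjection_prefixSpan hv, _root_.sum_apply]
  refine Finset.sum_congr rfl fun b _ => ?_
  split_ifs <;> simp

theorem ext_inner_of_orthonormal {v : Fin n → Eucl n} (hv : Orthonormal ℝ v) {x y : Eucl n}
    (h : ∀ a, inner ℝ (v a) x = inner ℝ (v a) y) : x = y := by
  have hs : ⊤ ≤ Submodule.span ℝ (Set.range v) :=
    (hv.linearIndependent.span_eq_top_of_card_eq_finrank' (by simp)).ge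
  refine InnerProductSpace.ext_inner_left_basis (OrthonormalBasis.mk hv hs).toBasis fun a => ?_
  simpa using h a

theorem cellCoord_cellFrame {v : Fin n → Eucl n} (hv : Orthonormal ℝ v) (X : CellModel k n) :
    cellCoord k v (fun i => (prefixSpan (k i) (cellFrame v X)).starProjection) = X := by
  ext p
  have hp := exists_lt_of_pos p
  change inner ℝ (v p.1.1) (obliqueProj (prefixSpan (k (nextIndex k p.1.2 hp))
    (cellFrame v X)).starProjection (prefixSpan (k (nextIndex k p.1.2 hp)) v).starProjection
      (v p.1.2)) = X p
  have hlt := lt_nextIndex p.1.2 hp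
  rw [obliqueProj_eq (isUnit_compareOp_cellFrame hv X _) (z := cellFrame v X p.1.2)
    (self_mem_prefixSpan hlt), inner_cellFrame hv, cellEntry, dif_pos p.2, if_neg, zero_add]
  · exact (lt_of_blockIndex_lt p.2).ne'
  · rw [starProjection_prefixSpan_of_orthonormal hv, starProjection_prefixSpan_of_orthonormal hv]
    refine Finset.sum_congr rfl fun b _ => ?_
    split_ifs with hb
    · rw [inner_cellFrame hv, orthonormal_iff_ite.1 hv, cellEntry, dif_neg, add_zero]
      intro hcon
      obtain ⟨j, hj1, hj2⟩ := exists_of_blockIndex_lt hcon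
      have := nextIndex_le p.1.2 hp hj1
      omega
    · rfl

theorem cellFrame_cellCoord {v : Fin n → Eucl n} (hv : Orthonormal ℝ v)
    {V : Fin d → Submodule ℝ (Eucl n)} (hmono : ∀ i j, k i ≤ k j → V i ≤ V j)
    (hfr : ∀ i, Module.finrank ℝ (V i) = Module.finrank ℝ (prefixSpan (k i) v))
    (hV : (fun i => (V i).starProjection) ∈ cellSet k v) (i : Fin d) :
    prefixSpan (k i) (cellFrame v (cellCoord k v fun i => (V i).starProjection)) = V i := by
  refine Submodule.eq_of_le_of_finrank_eq ?_ ?_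
  · rw [prefixSpan_le_iff]
    intro b hb
    have hex : ∃ i, (b : ℕ) < k i := ⟨i, hb⟩
    set i0 := nextIndex k b hex with hi0
    have hlt : (b : ℕ) < k i0 := lt_nextIndex b hex
    have hle : k i0 ≤ k i := nextIndex_le b hex hb
    refine hmono i0 i hle ?_
    set z := obliqueProj (V i0).starProjection (prefixSpan (k i0) v).starProjection (v b) with hz
    have hzV : z ∈ V i0 := obliqueProj_mem _ _ _
    have hzE : (prefixSpan (k i0) v).starProjection z =
        (prefixSpan (k i0) v).starProjection (v b) := proj_obliqueProj (hV i0) _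
    have hin : ∀ a : Fin n, (a : ℕ) < k i0 → inner ℝ (v a) z = if a = b then 1 else 0 := by
      intro a ha
      have h1 := congrArg (inner ℝ (v a)) hzE
      have hva : (prefixSpan (k i0) v).starProjection (v a) = v a :=
        Submodule.starProjection_eq_self_iff.2 (self_mem_prefixSpan ha)
      rw [← Submodule.inner_starProjection_left_eq_right,
        ← Submodule.inner_starProjection_left_eq_right, hva] at h1
      rw [h1, orthonormal_iff_ite.1 hv]
    have : cellFrame v (cellCoord k v fun i => (V i).starProjection) b = z := by
      refine ext_inner_of_orthonormal hv fun a => ?_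
      rw [inner_cellFrame hv]
      by_cases ha : (a : ℕ) < k i0
      · rw [hin a ha, cellEntry, dif_neg, add_zero]
        intro hcon
        obtain ⟨j, hj1, hj2⟩ := exists_of_blockIndex_lt hcon
        have : k i0 ≤ k j := nextIndex_le b hex hj1
        omega
      · rw [cellEntry, dif_pos (blockIndex_lt_of hlt (not_lt.1 ha)), if_neg, zero_add]
        · rfl
        · rintro rfl; exact ha hlt
    rw [this]
    exact hzV
  · rw [hfr, finrank_prefixSpan (cellFrame_linearIndependent hv _),
      finrank_prefixSpan hv.linearIndependent]

end Frames

/-! ### The flag manifold -/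

section FlagManifold

/-- Flags `V₁ ⊊ ⋯ ⊊ V_d` of subspaces of `ℝⁿ` with `dim V_i = k_i`. -/
def FlagManifold {d : ℕ} (k : Fin d → ℕ) (n : ℕ) : Type :=
  {V : Fin d → Submodule ℝ (Eucl n) // StrictMono V ∧ ∀ i, Module.finrank ℝ (V i) = k i}

variable {d : ℕ} {k : Fin d → ℕ} {n : ℕ}

/-- The embedding of the flag manifold into a product of Grassmannians, where a subspace is
represented by its orthogonal projection. -/
noncomputable def FlagManifold.toEnd (V : FlagManifold k n) : Fin d → Eucl n →L[ℝ] Eucl n :=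
  fun i => (V.1 i).starProjection

noncomputable instance FlagManifold.instTopologicalSpace : TopologicalSpace (FlagManifold k n) :=
  TopologicalSpace.induced FlagManifold.toEnd inferInstance

theorem FlagManifold.isInducing_toEnd :
    Topology.IsInducing (FlagManifold.toEnd (k := k) (n := n)) := ⟨rfl⟩

theorem FlagManifold.toEnd_injective :
    Function.Injective (FlagManifold.toEnd (k := k) (n := n)) := fun _ _ h =>
  Subtype.ext (funext fun i => Submodule.starProjection_inj.1 (congrFun h i))

theorem FlagManifold.mono (V : FlagManifold k n) (i j : Fin d) (h : k i ≤ k j) :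
    V.1 i ≤ V.1 j := by
  rcases le_or_gt i j with hij | hij
  · exact V.2.1.monotone hij
  · have := Submodule.finrank_lt_finrank_of_lt (V.2.1 hij)
    rw [V.2.2, V.2.2] at this
    omega

theorem exists_adapted_frame {V : Fin d → Submodule ℝ (Eucl n)}
    (hmono : ∀ i j, k i ≤ k j → V i ≤ V j) (hfr : ∀ i, Module.finrank ℝ (V i) = k i) :
    ∃ v : Fin n → Eucl n, Orthonormal ℝ v ∧ ∀ i, prefixSpan (k i) v = V i := by
  have key : ∀ j ≤ n, ∃ v : Fin n → Eucl n,
      (∀ a b : Fin n, (a : ℕ) < j → (b : ℕ) < j → inner ℝ (v a) (v b) = if a = b then 1 else 0) ∧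
      ∀ b : Fin n, (b : ℕ) < j → ∀ i, (b : ℕ) < k i → v b ∈ V i := by
    intro j
    induction j with
    | zero => exact fun _ => ⟨0, fun a _ h => by omega, fun b h => by omega⟩
    | succ j ih =>
      intro hj
      obtain ⟨v, hv1, hv2⟩ := ih (by omega)
      let c : Fin n := ⟨j, hj⟩
      obtain ⟨W, hW, hWV⟩ : ∃ W : Submodule ℝ (Eucl n), j < Module.finrank ℝ W ∧
          ∀ i, j < k i → W ≤ V i := by
        by_cases h : ∃ i, (c : ℕ) < k i
        · exact ⟨V (nextIndex k c h), by rw [hfr]; exact lt_nextIndex c h,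
            fun i hi => hmono _ _ (nextIndex_le c h hi)⟩
        · exact ⟨⊤, by simpa using hj, fun i hi => absurd ⟨i, hi⟩ h⟩
      let T : W →ₗ[ℝ] ({a : Fin n // (a : ℕ) < j} → ℝ) :=
        LinearMap.pi fun a => (innerSL ℝ (v a.1)).toLinearMap ∘ₗ W.subtype
      have hcard : Fintype.card {a : Fin n // (a : ℕ) < j} ≤ j := by
        have := Fintype.card_le_of_injective
          (fun a : {a : Fin n // (a : ℕ) < j} => (⟨a.1, a.2⟩ : Fin j))
          (fun a b h => Subtype.ext (Fin.ext (Fin.mk.inj h)))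
        simpa using this
      have hker : LinearMap.ker T ≠ ⊥ := LinearMap.ker_ne_bot_of_finrank_lt (by
        rw [Module.finrank_fintype_fun_eq_card]; omega)
      obtain ⟨x, hx, hx0⟩ := Submodule.exists_mem_ne_zero_of_ne_bot hker
      have hx0' : (x : Eucl n) ≠ 0 := fun h => hx0 (Subtype.ext h)
      have hxo : ∀ a : Fin n, (a : ℕ) < j → inner ℝ (v a) (x : Eucl n) = 0 := fun a ha =>
        congrFun (LinearMap.mem_ker.1 hx) ⟨a, ha⟩
      let y : Eucl n := (‖(x : Eucl n)‖⁻¹ : ℝ) • (x : Eucl n)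
      have hyn : ‖y‖ = 1 := norm_smul_inv_norm (𝕜 := ℝ) hx0'
      have hyo : ∀ a : Fin n, (a : ℕ) < j → inner ℝ (v a) y = 0 := fun a ha => by
        rw [inner_smul_right, hxo a ha, mul_zero]
      have hne : ∀ a : Fin n, (a : ℕ) < j → a ≠ c := by rintro _ h rfl; exact lt_irrefl _ h
      have hcases : ∀ a : Fin n, (a : ℕ) < j + 1 → (a : ℕ) < j ∨ a = c := fun a ha => by
        rcases Nat.lt_succ_iff_lt_or_eq.1 ha with h | h
        · exact Or.inl h
        · exact Or.inr (Fin.ext h)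
      refine ⟨Function.update v c y, fun a b ha hb => ?_, fun b hb i hi => ?_⟩
      · rcases hcases a ha with ha | rfl <;> rcases hcases b hb with hb | rfl
        · rw [Function.update_of_ne (hne a ha), Function.update_of_ne (hne b hb), hv1 a b ha hb]
        · rw [Function.update_of_ne (hne a ha), Function.update_self, hyo a ha, if_neg (hne a ha)]
        · rw [Function.update_of_ne (hne b hb), Function.update_self, real_inner_comm, hyo b hb,
            if_neg (hne b hb).symm]
        · rw [Function.update_self, real_inner_self_eq_norm_sq, hyn]; simp
      · rcases hcases b hb with hb | rfl
        · rw [Function.update_of_ne (hne b hb)]; exact hv2 b hb i hi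
        · rw [Function.update_self]; exact (V i).smul_mem _ (hWV i hi x.2)
  obtain ⟨v, hv1, hv2⟩ := key n le_rfl
  have hv : Orthonormal ℝ v := orthonormal_iff_ite.2 fun a b => hv1 a b a.2 b.2
  refine ⟨v, hv, fun i => Submodule.eq_of_le_of_finrank_eq
    (prefixSpan_le_iff.2 fun b hb => hv2 b b.2 i hb) ?_⟩
  have hkn : k i ≤ n := by
    have := (V i).finrank_le
    rwa [hfr, finrank_euclideanSpace_fin] at this
  rw [finrank_prefixSpan hv.linearIndependent, hfr,
    Fintype.card_congr (β := Fin (k i)) ⟨fun a => ⟨a.1, a.2⟩,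
      fun a => ⟨⟨a, by omega⟩, a.2⟩, fun _ => rfl, fun _ => rfl⟩, Fintype.card_fin]

theorem FlagManifold.exists_chart (V : FlagManifold k n) :
    ∃ e : OpenPartialHomeomorph (FlagManifold k n) (CellModel k n),
      IsSubmanifoldChart FlagManifold.toEnd e ∧ V ∈ e.source := by
  obtain ⟨v, hv, hvV⟩ := exists_adapted_frame V.mono V.2.2
  have hfr : ∀ i, Module.finrank ℝ (prefixSpan (k i) v) = k i := fun i => by rw [hvV, V.2.2]
  have hmono : ∀ i j, i < j → k i < k j := fun i j hij => by
    rw [← V.2.2 i, ← V.2.2 j]; exact Submodule.finrank_lt_finrank_of_lt (V.2.1 hij)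
  have hfr' : ∀ X i, Module.finrank ℝ (prefixSpan (k i) (cellFrame (k := k) v X)) = k i :=
    fun X i => by
      rw [finrank_prefixSpan (cellFrame_linearIndependent hv X),
        ← finrank_prefixSpan hv.linearIndependent, hfr]
  let ψ : CellModel k n → FlagManifold k n := fun X =>
    ⟨fun i => prefixSpan (k i) (cellFrame v X), fun i j hij => by
      refine lt_of_le_of_ne (prefixSpan_le_iff.2 fun b hb =>
        self_mem_prefixSpan (hb.trans (hmono i j hij))) fun h => ?_
      have h1 : prefixSpan (k i) (cellFrame v X) = prefixSpan (k j) (cellFrame v X) := h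
      have h2 := hfr' X i
      rw [h1, hfr' X j] at h2
      exact absurd h2 (hmono i j hij).ne', hfr' X⟩
  obtain ⟨e, he, hs⟩ := exists_isSubmanifoldChart (FlagManifold.isInducing_toEnd (k := k) (n := n))
    (isOpen_cellSet k v) (contDiffOn_cellCoord k v) (ψ := ψ)
    (contDiff_pi.2 fun i => contDiff_starProjection_cellFrame hv (k i))
    (fun X i => isUnit_compareOp_cellFrame hv X (k i))
    (cellCoord_cellFrame hv)
    (fun W hW => Subtype.ext (funext fun i =>
      cellFrame_cellCoord hv W.mono (fun i => by rw [W.2.2, hfr]) hW i))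
  refine ⟨e, he, ?_⟩
  rw [hs]
  intro i
  have h := isUnit_compareOp (V := V.1 i) (S := V.1 i) rfl (Submodule.orthogonal_disjoint _)
  change IsUnit (compareOp (V.1 i).starProjection (prefixSpan (k i) v).starProjection)
  simp only [hvV i]
  exact h

/-- The flag manifold as an embedded submanifold of a product of Grassmannians. -/
noncomputable instance FlagManifold.instChartedSpace :
    ChartedSpace (CellModel k n) (FlagManifold k n) :=
  submanifoldChartedSpace FlagManifold.toEnd FlagManifold.exists_chart

instance FlagManifold.instIsManifold : IsManifold 𝓘(ℝ, CellModel k n) ∞ (FlagManifold k n) :=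
  IsSubmanifoldChart.isManifold (ι := FlagManifold.toEnd) fun _ h => h

end FlagManifold

/-! ### Homogeneous spaces -/

section Homogeneous

/-- An admissible chart `e` of the quotient `G ⧸ H`: its composition with the quotient map is
smooth, and its inverse lifts locally to smooth maps into `G`. -/
structure IsQuotientChart {G : Type*} (E : Type*) {F : Type*} [Group G] [TopologicalSpace G]
    [NormedAddCommGroup E] [NormedSpace ℝ E] [ChartedSpace E G]
    [NormedAddCommGroup F] [NormedSpace ℝ F]
    (H : Subgroup G) (e : OpenPartialHomeomorph (G ⧸ H) F) : Prop where
  contMDiffOn_comp_mk : ContMDiffOn 𝓘(ℝ, E) 𝓘(ℝ, F) ∞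
    (fun g : G => e (g : G ⧸ H)) {g : G | (g : G ⧸ H) ∈ e.source}
  exists_lift : ∀ x ∈ e.target, ∃ s : F → G,
    ContMDiffAt 𝓘(ℝ, F) 𝓘(ℝ, E) ∞ s x ∧ ∀ᶠ y in 𝓝 x, (s y : G ⧸ H) = e.symm y

/-- The manifold structure of the homogeneous space `G ⧸ H`: the atlas consists of all
admissible charts of the topological quotient. -/
@[reducible]
noncomputable def quotientChartedSpace {G : Type*} (E : Type*) {F : Type*} [Group G] [TopologicalSpace G]
    [NormedAddCommGroup E] [NormedSpace ℝ E] [ChartedSpace E G]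
    [NormedAddCommGroup F] [NormedSpace ℝ F] (H : Subgroup G)
    (h : ∀ x, ∃ e : OpenPartialHomeomorph (G ⧸ H) F, IsQuotientChart E H e ∧ x ∈ e.source) :
    ChartedSpace F (G ⧸ H) where
  atlas := {e | IsQuotientChart E H e}
  chartAt x := (h x).choose
  mem_chart_source x := (h x).choose_spec.2
  chart_mem_atlas x := (h x).choose_spec.1

theorem IsQuotientChart.isManifold {G E F : Type*} [Group G] [TopologicalSpace G]
    [NormedAddCommGroup E] [NormedSpace ℝ E] [ChartedSpace E G]
    [NormedAddCommGroup F] [NormedSpace ℝ F] {H : Subgroup G}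
    [ChartedSpace F (G ⧸ H)]
    (h : ∀ e ∈ atlas F (G ⧸ H), IsQuotientChart E H e) : IsManifold 𝓘(ℝ, F) ∞ (G ⧸ H) := by
  refine isManifold_of_contDiffOn _ _ _ fun e e' he he' => ?_
  simp only [modelWithCornersSelf_coe, modelWithCornersSelf_coe_symm, Function.id_comp,
    Function.comp_id, Set.preimage_id, Set.range_id, Set.inter_univ]
  intro x hx
  have hx1 : x ∈ e.target := by simpa using hx.1
  have hx2 : e.symm x ∈ e'.source := by simpa using hx.2
  obtain ⟨s, hs, hev⟩ := (h e he).exists_lift _ hx1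
  have hsx : (s x : G ⧸ H) = e.symm x := hev.self_of_nhds
  have hopen : IsOpen {g : G | (g : G ⧸ H) ∈ e'.source} :=
    e'.open_source.preimage QuotientGroup.continuous_mk
  have h1 : ContMDiffAt 𝓘(ℝ, E) 𝓘(ℝ, F) ∞ (fun g : G => e' (g : G ⧸ H)) (s x) :=
    (h e' he').contMDiffOn_comp_mk.contMDiffAt (hopen.mem_nhds (by
      change (s x : G ⧸ H) ∈ e'.source; rwa [hsx]))
  have h2 := (ContMDiffAt.comp x h1 hs).contDiffAt
  refine (h2.congr_of_eventuallyEq ?_).contDiffWithinAt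
  filter_upwards [hev] with y hy
  simp [hy]

variable {d : ℕ} (k : Fin d → ℕ) (n : ℕ)

/-- The subgroup `S(O(n₁) × O(n₂ - n₁) × ⋯ × O(n - n_d))` of `SO(n)`: the block diagonal matrices
with orthogonal diagonal blocks `Q_j` and `∏ j, det Q_j = 1`. -/
noncomputable def blockSO : Subgroup (SO n) where
  carrier := {A | ∃ Q : ∀ j : Fin (d + 1),
    Matrix {a : Fin n // blockIndex k a = j} {a : Fin n // blockIndex k a = j} ℝ,
      (∀ j, Q j ∈ Matrix.orthogonalGroup {a : Fin n // blockIndex k a = j} ℝ) ∧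
      ∏ j, (Q j).det = 1 ∧
      (A : Matrix (Fin n) (Fin n) ℝ) =
        Matrix.reindex (Equiv.sigmaFiberEquiv (blockIndex k)) (Equiv.sigmaFiberEquiv (blockIndex k))
          (Matrix.blockDiagonal' Q)}
  one_mem' := ⟨fun _ => 1, fun _ => one_mem _, by simp, by
    have : (fun j : Fin (d + 1) => (1 : Matrix {a : Fin n // blockIndex k a = j}
      {a : Fin n // blockIndex k a = j} ℝ)) = 1 := rfl
    rw [this, Matrix.blockDiagonal'_one]; simp⟩
  mul_mem' := by
    rintro A B ⟨Q, hQ, hQd, hA⟩ ⟨R, hR, hRd, hB⟩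
    refine ⟨fun j => Q j * R j, fun j => mul_mem (hQ j) (hR j), ?_, ?_⟩
    · simp only [Matrix.det_mul, Finset.prod_mul_distrib, hQd, hRd, mul_one]
    · change A.1 * B.1 = _
      rw [hA, hB, Matrix.blockDiagonal'_mul]
      simp [Matrix.submatrix_mul_equiv]
  inv_mem' := by
    rintro A ⟨Q, hQ, hQd, hA⟩
    refine ⟨fun j => (Q j)ᵀ, fun j => ?_, ?_, ?_⟩
    · rw [Matrix.mem_orthogonalGroup_iff, Matrix.transpose_transpose]
      exact (Matrix.mem_orthogonalGroup_iff' _ _).1 (hQ j)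
    · simpa only [Matrix.det_transpose] using hQd
    · rw [SO.coe_inv, hA, ← Matrix.blockDiagonal'_transpose]
      rfl

variable {k n}

theorem mem_blockSO_iff {A : SO n} :
    A ∈ blockSO k n ↔ ∀ a b, blockIndex k a ≠ blockIndex k b → A.1 a b = 0 := by
  constructor
  · rintro ⟨Q, -, -, hA⟩ a b hab
    rw [hA]
    exact Matrix.blockDiagonal'_apply_ne Q _ _ hab
  · intro h
    let e := Equiv.sigmaFiberEquiv (blockIndex (n := n) k)
    let Q : ∀ j : Fin (d + 1),
        Matrix {a : Fin n // blockIndex k a = j} {a : Fin n // blockIndex k a = j} ℝ :=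
      fun j => Matrix.of fun a b => A.1 a b
    have hQ : A.1 = Matrix.reindex e e (Matrix.blockDiagonal' Q) := by
      ext a b
      by_cases hab : blockIndex k a = blockIndex k b
      · obtain ⟨⟨i, a⟩, rfl⟩ := e.surjective a
        obtain ⟨⟨j, b⟩, rfl⟩ := e.surjective b
        have hij : i = j := by
          have h1 : blockIndex k (e ⟨i, a⟩) = i := a.2
          have h2 : blockIndex k (e ⟨j, b⟩) = j := b.2
          rw [← h1, ← h2, hab]
        subst hij
        simp only [Matrix.reindex_apply, Matrix.submatrix_apply, Equiv.symm_apply_apply,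
          Matrix.blockDiagonal'_apply_eq]
        rfl
      · rw [h a b hab]
        exact (Matrix.blockDiagonal'_apply_ne Q _ _ hab).symm
    have hQo : (fun j => Q j * (Q j)ᵀ) = 1 := by
      apply Matrix.blockDiagonal'_injective
      rw [Matrix.blockDiagonal'_mul, ← Matrix.blockDiagonal'_transpose, Matrix.blockDiagonal'_one]
      apply (Matrix.reindex e e).injective
      have := SO.mul_transpose A
      rw [hQ] at this
      simpa [Matrix.submatrix_mul_equiv] using this
    refine ⟨Q, fun j => (Matrix.mem_orthogonalGroup_iff _ _).2 (congrFun hQo j), ?_, hQ⟩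
    have hbt : A.1.BlockTriangular (blockIndex k) := fun a b hab => h a b hab.ne'
    have := hbt.det_fintype
    rw [SO.det_eq_one] at this
    exact this.symm

/-- The columns of a matrix in `SO(n)`. -/
noncomputable def SO.frame (A : SO n) (b : Fin n) : Eucl n :=
  SO.toEnd A (EuclideanSpace.single b 1)

theorem SO.frame_apply (A : SO n) (a b : Fin n) : SO.frame A b a = A.1 a b := by
  have : SO.frame A b a = (A.1 *ᵥ (Pi.single b 1)) a := rfl
  rw [this, Matrix.mulVec_single_one]; rfl

theorem SO.inner_frame (A B : SO n) (a b : Fin n) :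
    inner ℝ (SO.frame A a) (SO.frame B b) = (A.1ᵀ * B.1) a b := by
  rw [PiLp.inner_apply, Matrix.mul_apply]
  refine Finset.sum_congr rfl fun c _ => ?_
  rw [SO.frame_apply, SO.frame_apply]
  simp [mul_comm]

theorem SO.frame_orthonormal (A : SO n) : Orthonormal ℝ (SO.frame A) := by
  rw [orthonormal_iff_ite]
  intro a b
  rw [SO.inner_frame, SO.transpose_mul, Matrix.one_apply]

theorem SO.inv_mul_mem_iff (A B : SO n) :
    A⁻¹ * B ∈ blockSO k n ↔ ∀ i, prefixSpan (k i) (SO.frame A) = prefixSpan (k i) (SO.frame B) := by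
  have hentry : ∀ a b, (A⁻¹ * B).1 a b = inner ℝ (SO.frame A a) (SO.frame B b) := fun a b => by
    rw [SO.inner_frame]; rfl
  rw [mem_blockSO_iff]
  constructor
  · intro h i
    have hle : prefixSpan (k i) (SO.frame B) ≤ prefixSpan (k i) (SO.frame A) := by
      rw [prefixSpan_le_iff]
      intro b hb
      have : SO.frame B b = ∑ a, (A⁻¹ * B).1 a b • SO.frame A a := by
        refine ext_inner_of_orthonormal A.frame_orthonormal fun a => ?_
        rw [A.frame_orthonormal.inner_right_fintype, hentry]
      rw [this]
      refine Submodule.sum_mem _ fun a _ => ?_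
      by_cases ha : (a : ℕ) < k i
      · exact Submodule.smul_mem _ _ (self_mem_prefixSpan ha)
      · rw [h a b (blockIndex_lt_of hb (not_lt.1 ha)).ne', zero_smul]
        exact Submodule.zero_mem _
    refine (Submodule.eq_of_le_of_finrank_eq hle ?_).symm
    rw [finrank_prefixSpan A.frame_orthonormal.linearIndependent,
      finrank_prefixSpan B.frame_orthonormal.linearIndependent]
  · intro h a b hab
    rw [hentry]
    rcases lt_or_gt_of_ne hab with hlt | hlt
    · obtain ⟨i, ha, hb⟩ := exists_of_blockIndex_lt hlt
      have h1 : SO.frame A a ∈ prefixSpan (k i) (SO.frame B) := h i ▸ self_mem_prefixSpan ha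
      obtain ⟨c, hc, hx⟩ := mem_prefixSpan.1 h1
      rw [← hx, B.frame_orthonormal.inner_left_fintype, hc b hb]; simp
    · obtain ⟨i, hb, ha⟩ := exists_of_blockIndex_lt hlt
      have h1 : SO.frame B b ∈ prefixSpan (k i) (SO.frame A) := h i ▸ self_mem_prefixSpan hb
      obtain ⟨c, hc, hx⟩ := mem_prefixSpan.1 h1
      rw [← hx, A.frame_orthonormal.inner_right_fintype, hc a ha]

/-- The square matrix with given columns. -/
noncomputable def columnMatrix (n : ℕ) : (Fin n → Eucl n) →ₗ[ℝ] Matrix (Fin n) (Fin n) ℝ where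
  toFun w := Matrix.of fun a b => w b a
  map_add' _ _ := rfl
  map_smul' _ _ := rfl

/-- The family obtained from `w` by multiplying the first vector by the determinant. -/
noncomputable def positiveFrame (w : Fin n → Eucl n) (b : Fin n) : Eucl n :=
  if (b : ℕ) = 0 then (columnMatrix n w).det • w b else w b

theorem columnMatrix_orthonormal {w : Fin n → Eucl n} (hw : Orthonormal ℝ w) :
    (columnMatrix n w)ᵀ * columnMatrix n w = 1 := by
  ext a b
  have := orthonormal_iff_ite.1 hw a b
  rw [PiLp.inner_apply] at this
  rw [Matrix.one_apply, ← this, Matrix.mul_apply]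
  refine Finset.sum_congr rfl fun c _ => ?_
  change w a c * w b c = _
  simp [mul_comm]

theorem det_columnMatrix_mul_self {w : Fin n → Eucl n} (hw : Orthonormal ℝ w) :
    (columnMatrix n w).det * (columnMatrix n w).det = 1 := by
  have := congrArg Matrix.det (columnMatrix_orthonormal hw)
  rwa [Matrix.det_mul, Matrix.det_transpose, Matrix.det_one] at this

theorem positiveFrame_orthonormal {w : Fin n → Eucl n} (hw : Orthonormal ℝ w) :
    Orthonormal ℝ (positiveFrame w) := by
  have hd := det_columnMatrix_mul_self hw
  have hw' := orthonormal_iff_ite.1 hw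
  rw [orthonormal_iff_ite]
  intro a b
  unfold positiveFrame
  by_cases ha : (a : ℕ) = 0 <;> by_cases hb : (b : ℕ) = 0
  · have : a = b := Fin.ext (by omega)
    subst this
    rw [if_pos ha, if_pos rfl, inner_smul_left, inner_smul_right, hw', if_pos rfl, mul_one]
    exact hd
  · have : a ≠ b := by rintro rfl; exact hb ha
    simp [ha, hb, inner_smul_left, hw', this]
  · have : a ≠ b := by rintro rfl; exact ha hb
    simp [ha, hb, inner_smul_right, hw', this]
  · simp [ha, hb, hw']

theorem det_positiveFrame {w : Fin n → Eucl n} (hw : Orthonormal ℝ w) :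
    (columnMatrix n (positiveFrame w)).det = 1 := by
  rcases Nat.eq_zero_or_pos n with rfl | hn
  · simp
  · have : columnMatrix n (positiveFrame w) = (columnMatrix n w).updateCol ⟨0, hn⟩
        ((columnMatrix n w).det • fun a => columnMatrix n w a ⟨0, hn⟩) := by
      ext a b
      by_cases hb : b = ⟨0, hn⟩
      · subst hb
        change positiveFrame w ⟨0, hn⟩ a = _
        rw [positiveFrame, if_pos rfl, Matrix.updateCol_self]
        rfl
      · have hb' : (b : ℕ) ≠ 0 := fun h => hb (Fin.ext h)
        change positiveFrame w b a = _
        rw [positiveFrame, if_neg hb', Matrix.updateCol_ne hb]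
        rfl
    rw [this, Matrix.det_updateCol_smul]
    have h2 : (columnMatrix n w).updateCol ⟨0, hn⟩ (fun a => columnMatrix n w a ⟨0, hn⟩) =
        columnMatrix n w := Matrix.updateCol_eq_self _ _
    rw [h2, det_columnMatrix_mul_self hw]

theorem prefixSpan_positiveFrame {w : Fin n → Eucl n} (hw : Orthonormal ℝ w) (m : ℕ) :
    prefixSpan m (positiveFrame w) = prefixSpan m w := by
  refine Submodule.eq_of_le_of_finrank_eq (prefixSpan_le_iff.2 fun b hb => ?_) ?_
  · unfold positiveFrame
    split_ifs
    · exact Submodule.smul_mem _ _ (self_mem_prefixSpan hb)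
    · exact self_mem_prefixSpan hb
  · rw [finrank_prefixSpan hw.linearIndependent,
      finrank_prefixSpan (positiveFrame_orthonormal hw).linearIndependent]

/-- The rotation whose columns are `positiveFrame w`. -/
noncomputable def SO.ofFrame (w : Fin n → Eucl n) (hw : Orthonormal ℝ w) : SO n :=
  SO.mk (columnMatrix n (positiveFrame w)) (columnMatrix_orthonormal (positiveFrame_orthonormal hw))
    (det_positiveFrame hw)

theorem SO.frame_ofFrame (w : Fin n → Eucl n) (hw : Orthonormal ℝ w) :
    SO.frame (SO.ofFrame w hw) = positiveFrame w := by
  funext b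
  ext a
  rw [SO.frame_apply]
  rfl

theorem contDiff_positiveFrame {G : Type*} [NormedAddCommGroup G] [NormedSpace ℝ G]
    {w : G → Fin n → Eucl n} (hw : ∀ b, ContDiff ℝ ∞ fun x => w x b) (b : Fin n) :
    ContDiff ℝ ∞ fun x => positiveFrame (w x) b := by
  unfold positiveFrame
  split_ifs
  · refine ContDiff.smul (f := fun x => (columnMatrix n (w x)).det) (g := fun x => w x b) ?_ (hw b)
    simp only [Matrix.det_apply]
    refine ContDiff.sum fun σ _ => ContDiff.const_smul _ (contDiff_prod fun c _ => ?_)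
    exact (EuclideanSpace.proj (𝕜 := ℝ) (σ c)).contDiff.comp (hw c)
  · exact hw b

theorem contMDiff_ofFrame {G : Type*} [NormedAddCommGroup G] [NormedSpace ℝ G]
    {w : G → Fin n → Eucl n} (hw : ∀ b, ContDiff ℝ ∞ fun x => w x b)
    (ho : ∀ x, Orthonormal ℝ (w x)) :
    ContMDiff 𝓘(ℝ, G) 𝓘(ℝ, SkewModel n) ∞ fun x => SO.ofFrame (w x) (ho x) := by
  refine IsSubmanifoldChart.contMDiff_of_comp (F := SkewModel n) (ι := SO.toEnd) (SO.isInducing_toEnd n) (fun _ h => h) ?_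
  rw [contMDiff_iff_contDiff]
  let L : (Fin n → Eucl n) →ₗ[ℝ] (Eucl n →L[ℝ] Eucl n) :=
    (Matrix.toEuclideanCLM (n := Fin n) (𝕜 := ℝ)).toAlgEquiv.toLinearEquiv.toLinearMap ∘ₗ
      columnMatrix n
  exact L.toContinuousLinearMap.contDiff.comp (contDiff_pi.2 (contDiff_positiveFrame hw))

/-- The subspaces spanned by the leading columns. -/
noncomputable def quotientFlag (q : SO n ⧸ blockSO k n) (i : Fin d) : Submodule ℝ (Eucl n) :=
  Quotient.lift (fun A : SO n => prefixSpan (k i) (SO.frame A))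
    (fun A B h => (SO.inv_mul_mem_iff A B).1 (QuotientGroup.leftRel_apply.1 h) i) q

/-- The orthogonal projections onto the subspaces spanned by the leading columns. -/
noncomputable def leadingProj (k : Fin d → ℕ) (T : Eucl n →L[ℝ] Eucl n) (i : Fin d) :
    Eucl n →L[ℝ] Eucl n :=
  ∑ b : Fin n, if (b : ℕ) < k i then
    (innerSL ℝ (T (EuclideanSpace.single b 1))).smulRight (T (EuclideanSpace.single b 1)) else 0

theorem starProjection_frame (A : SO n) :
    (fun i => (prefixSpan (k i) (SO.frame A)).starProjection) = leadingProj k (SO.toEnd A) :=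
  funext fun i => starProjection_prefixSpan A.frame_orthonormal (k i)

theorem contDiff_leadingProj : ContDiff ℝ ∞ (leadingProj (n := n) k) := by
  refine contDiff_pi.2 fun i => ?_
  refine ContDiff.sum fun b _ => ?_
  split_ifs
  · exact contDiff_smulRight_self (contDiff_id.clm_apply contDiff_const)
  · exact contDiff_const

theorem continuous_quotientFlag :
    Continuous fun (q : SO n ⧸ blockSO k n) i => (quotientFlag q i).starProjection := by
  rw [(QuotientGroup.isQuotientMap_mk _).continuous_iff]
  have : (fun (q : SO n ⧸ blockSO k n) i => (quotientFlag q i).starProjection) ∘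
      QuotientGroup.mk = leadingProj k ∘ SO.toEnd := funext starProjection_frame
  rw [this]
  exact contDiff_leadingProj.continuous.comp (SO.isInducing_toEnd n).continuous

theorem blockSO_exists_chart (q : SO n ⧸ blockSO k n) :
    ∃ e : OpenPartialHomeomorph (SO n ⧸ blockSO k n) (CellModel k n),
      IsQuotientChart (SkewModel n) (blockSO k n) e ∧ q ∈ e.source := by
  obtain ⟨g, rfl⟩ := QuotientGroup.mk_surjective q
  let v := SO.frame g
  have hv : Orthonormal ℝ v := g.frame_orthonormal
  let s : CellModel k n → SO n := fun X => SO.ofFrame (orthoFrame v X) (orthoFrame_orthonormal hv X)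
  have hs : ContMDiff 𝓘(ℝ, CellModel k n) 𝓘(ℝ, SkewModel n) ∞ s :=
    contMDiff_ofFrame (contDiff_orthoFrame hv) (orthoFrame_orthonormal hv)
  let ι : SO n ⧸ blockSO k n → Fin d → Eucl n →L[ℝ] Eucl n :=
    fun q i => (quotientFlag q i).starProjection
  have hsflag : ∀ X i, prefixSpan (k i) (SO.frame (s X)) = prefixSpan (k i) (cellFrame v X) := by
    intro X i
    rw [SO.frame_ofFrame, prefixSpan_positiveFrame (orthoFrame_orthonormal hv X)]
    exact prefixSpan_gramSchmidtNormed _ _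
  have hιs : ∀ X, ι (s X : SO n ⧸ blockSO k n) =
      fun i => (prefixSpan (k i) (cellFrame v X)).starProjection := by
    intro X
    funext i
    change (prefixSpan (k i) (SO.frame (s X))).starProjection = _
    simp only [hsflag]
  let e : OpenPartialHomeomorph (SO n ⧸ blockSO k n) (CellModel k n) :=
    { toFun := fun q => cellCoord k v (ι q)
      invFun := fun X => (s X : SO n ⧸ blockSO k n)
      source := ι ⁻¹' cellSet k v
      target := Set.univ
      map_source' := fun _ _ => trivial
      map_target' := fun X _ => by
        change ι _ ∈ cellSet k v
        rw [hιs]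
        exact fun i => isUnit_compareOp_cellFrame hv X (k i)
      left_inv' := fun q hq => by
        obtain ⟨A, rfl⟩ := QuotientGroup.mk_surjective q
        rw [QuotientGroup.eq, SO.inv_mul_mem_iff]
        intro i
        rw [hsflag]
        refine cellFrame_cellCoord hv (V := fun i => prefixSpan (k i) (SO.frame A))
          (fun i j hij => prefixSpan_le_iff.2 fun b hb => self_mem_prefixSpan (hb.trans_le hij))
          (fun i => ?_) hq i
        rw [finrank_prefixSpan A.frame_orthonormal.linearIndependent,
          finrank_prefixSpan hv.linearIndependent]
      right_inv' := fun X _ => by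
        rw [hιs]
        exact cellCoord_cellFrame hv X
      open_source := (isOpen_cellSet k v).preimage continuous_quotientFlag
      open_target := isOpen_univ
      continuousOn_toFun := (contDiffOn_cellCoord k v).continuousOn.comp
        continuous_quotientFlag.continuousOn fun _ h => h
      continuousOn_invFun := (QuotientGroup.continuous_mk.comp hs.continuous).continuousOn }
  refine ⟨e, ⟨?_, fun X _ => ⟨s, hs X, Filter.Eventually.of_forall fun _ => rfl⟩⟩, ?_⟩
  · have h1 : ContMDiff 𝓘(ℝ, SkewModel n) 𝓘(ℝ, Fin d → Eucl n →L[ℝ] Eucl n) ∞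
        (leadingProj k ∘ SO.toEnd) :=
      contDiff_leadingProj.contMDiff.comp (SO.contMDiff_toEnd n)
    have h2 : ∀ A : SO n, ι (A : SO n ⧸ blockSO k n) = leadingProj k (SO.toEnd A) :=
      starProjection_frame
    refine ((contDiffOn_cellCoord k v).contMDiffOn.comp h1.contMDiffOn fun A hA => ?_).congr
      fun A _ => ?_
    · change leadingProj k (SO.toEnd A) ∈ cellSet k v
      rw [← h2]
      exact hA
    · change cellCoord k v (ι _) = cellCoord k v (leadingProj k (SO.toEnd A))
      rw [h2]
  · intro i
    exact isUnit_compareOp (V := prefixSpan (k i) v) rfl (Submodule.orthogonal_disjoint _)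

/-- The homogeneous space `SO(n) / S(O(n₁) × O(n₂ - n₁) × ⋯ × O(n - n_d))`. -/
noncomputable instance blockSO.instChartedSpace :
    ChartedSpace (CellModel k n) (SO n ⧸ blockSO k n) :=
  quotientChartedSpace (SkewModel n) (blockSO k n) blockSO_exists_chart

instance blockSO.instIsManifold :
    IsManifold 𝓘(ℝ, CellModel k n) ∞ (SO n ⧸ blockSO k n) :=
  IsQuotientChart.isManifold (E := SkewModel n) fun _ h => h

end Homogeneous

/-! ### Lie group structure and compactness of `SO n`. -/

section LieGroupStructure

/-! A rotation determines the flag whose members are the spans of its leading columns. Two rotations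
`A`, `B` give the same flag exactly when `A⁻¹ * B` is block diagonal (`SO.inv_mul_mem_iff`), so the
map descends to an injection on cosets. It is onto, because every flag has an adapted orthonormal
basis, and multiplying the first vector by the determinant `±1` makes that basis a rotation without
changing any leading span.

Smoothness of this bijection in both directions is checked by explicit formulas, with no appeal to
an inverse function theorem. From cosets to flags, a smooth function on the quotient is one whose
pullback to `SO n` is smooth (`IsQuotientChart.contMDiff_of_comp_mk`), and a smooth map into a
submanifold is one that is smooth into the ambient space (`IsSubmanifoldChart.contMDiff_of_comp`).
After both reductions the map sends a matrix to sums of rank-one projections onto its columns, which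
is polynomial. From flags to cosets, a frame `v` adapted to a given flag has around it an open cell
of flags. There a flag has coordinates `cellCoord`, the coordinates give a block unipotent frame,
Gram–Schmidt makes it orthonormal, and the determinant correction turns it into a rotation. Each
step is smooth, and the composite inverts the bijection on the cell
(`contMDiff_symm_flagOfQuotient`).

The group statements come from the embedding in matrices: multiplication and inversion restrict
smooth ambient maps, and `SO n` is closed with bounded entries. For connectedness, every rotation is
a product of hyperplane reflections. A product of two reflections is joined to the identity by
moving one mirror onto the other, so all products of reflections lie in two cosets of the identity
component, told apart by the determinant. The action on the quotient is smooth because the quotient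
map has smooth local sections. -/

theorem SO.toEnd_mul {n : ℕ} (A B : SO n) : SO.toEnd (A * B) = SO.toEnd A * SO.toEnd B :=
  map_mul (Matrix.toEuclideanCLM (n := Fin n) (𝕜 := ℝ)) _ _

theorem SO.toEnd_one (n : ℕ) : SO.toEnd (1 : SO n) = 1 :=
  map_one (Matrix.toEuclideanCLM (n := Fin n) (𝕜 := ℝ))

theorem SO.isUnit_toEnd {n : ℕ} (A : SO n) : IsUnit (SO.toEnd A) :=
  ⟨⟨SO.toEnd A, SO.toEnd A⁻¹, by rw [← SO.toEnd_mul, mul_inv_cancel, SO.toEnd_one],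
    by rw [← SO.toEnd_mul, inv_mul_cancel, SO.toEnd_one]⟩, rfl⟩

/-- Expresses inversion through a function on the whole ambient algebra, which is smooth at every
unit. -/
theorem SO.toEnd_inv {n : ℕ} (A : SO n) : SO.toEnd A⁻¹ = Ring.inverse (SO.toEnd A) := by
  have h : SO.toEnd A * SO.toEnd A⁻¹ = 1 := by
    rw [← SO.toEnd_mul, mul_inv_cancel, SO.toEnd_one]
  rw [← one_mul (SO.toEnd A⁻¹), ← Ring.inverse_mul_cancel _ A.isUnit_toEnd, mul_assoc, h, mul_one]

instance SO.instLieGroup (n : ℕ) : LieGroup 𝓘(ℝ, SkewModel n) ∞ (SO n) where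
  contMDiff_mul := by
    -- Smoothness may be tested after inclusion into the ambient algebra, where multiplication is
    -- bilinear. The argument `fun _ h => h` works because the atlas is by definition the set of
    -- admissible charts.
    refine IsSubmanifoldChart.contMDiff_of_comp (F := SkewModel n) (ι := SO.toEnd)
      (SO.isInducing_toEnd n) (fun _ h => h) ?_
    have h1 := (SO.contMDiff_toEnd n).comp
      (contMDiff_fst (I := 𝓘(ℝ, SkewModel n)) (J := 𝓘(ℝ, SkewModel n)) (M := SO n) (N := SO n))
    have h2 := (SO.contMDiff_toEnd n).comp
      (contMDiff_snd (I := 𝓘(ℝ, SkewModel n)) (J := 𝓘(ℝ, SkewModel n)) (M := SO n) (N := SO n))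
    exact (h1.clm_comp h2).congr fun p => SO.toEnd_mul p.1 p.2
  contMDiff_inv := by
    refine IsSubmanifoldChart.contMDiff_of_comp (F := SkewModel n) (ι := SO.toEnd)
      (SO.isInducing_toEnd n) (fun _ h => h) fun A => ?_
    obtain ⟨u, hu⟩ := A.isUnit_toEnd
    have h : ContDiffAt ℝ ∞ Ring.inverse (SO.toEnd A) := hu ▸ contDiffAt_ringInverse ℝ u
    exact (h.contMDiffAt.comp A (SO.contMDiff_toEnd n A)).congr_of_eventuallyEq
      (Filter.Eventually.of_forall SO.toEnd_inv)

instance SO.instCompactSpace (n : ℕ) : CompactSpace (SO n) := by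
  refine isCompact_iff_compactSpace.1 ?_
  -- Heine–Borel in the product topology on matrices: the group is a closed subset of a cube.
  refine IsCompact.of_isClosed_subset
    (isCompact_univ_pi fun _ : Fin n => isCompact_univ_pi fun _ : Fin n =>
      isCompact_closedBall (0 : ℝ) 1) ?_ fun A hA i _ j _ => ?_
  · have : (Matrix.specialOrthogonalGroup (Fin n) ℝ : Set (Matrix (Fin n) (Fin n) ℝ)) =
        {A | A * Aᵀ = 1} ∩ {A | A.det = 1} := by
      ext A
      exact and_congr (Matrix.mem_orthogonalGroup_iff _ _) Iff.rfl
    rw [this]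
    exact (isClosed_eq (by fun_prop) continuous_const).inter
      (isClosed_eq (by fun_prop) continuous_const)
  -- The rows of an orthogonal matrix are unit vectors, so its entries lie in `[-1, 1]`.
  · simpa using entry_norm_bound_of_unitary (𝕜 := ℝ) hA.1 i j

end LieGroupStructure

/-! ### Connectedness of `SO n` by hyperplane reflections. -/

section Connected

variable {n : ℕ}

/-- The matrix of the reflection in the hyperplane orthogonal to `v`. -/
noncomputable def householder (v : Eucl n) : Matrix (Fin n) (Fin n) ℝ :=
  (Matrix.toEuclideanCLM (n := Fin n) (𝕜 := ℝ)).symm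
    (1 - (2 / ‖v‖ ^ 2) • (innerSL ℝ v).smulRight v)

/-- Links the explicit rank-one formula, which shows continuity in `v`, with the geometric
reflection, which gives involutivity, symmetry, the determinant and generation. For `v = 0` both
sides are the identity. -/
theorem toEuclideanCLM_householder (v : Eucl n) :
    Matrix.toEuclideanCLM (n := Fin n) (𝕜 := ℝ) (householder v) =
      (Submodule.span ℝ {v})ᗮ.reflection.toContinuousLinearEquiv.toContinuousLinearMap := by
  rw [householder, StarAlgEquiv.apply_symm_apply]
  ext1 x
  simp [Submodule.reflection_orthogonal_apply, Submodule.reflection_singleton_apply, smul_smul]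
  module

theorem toEuclideanCLM_injective :
    Function.Injective (Matrix.toEuclideanCLM (n := Fin n) (𝕜 := ℝ)) :=
  EquivLike.injective _

theorem householder_mul_self (v : Eucl n) : householder v * householder v = 1 := by
  apply toEuclideanCLM_injective
  rw [map_mul, map_one, toEuclideanCLM_householder]
  ext1 x
  rw [mul_apply_eq_comp]
  exact Submodule.reflection_reflection (Submodule.span ℝ {v})ᗮ x

theorem householder_transpose (v : Eucl n) : (householder v)ᵀ = householder v := by
  apply toEuclideanCLM_injective
  have h : star (householder v) = (householder v)ᵀ := rfl
  rw [← h, map_star, ContinuousLinearMap.star_eq_adjoint, eq_comm,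
    ContinuousLinearMap.eq_adjoint_iff, toEuclideanCLM_householder]
  intro x y
  -- An isometric involution `R` is self-adjoint: `⟪R x, y⟫ = ⟪R x, R (R y)⟫ = ⟪x, R y⟫`.
  have h := LinearIsometryEquiv.inner_map_map (Submodule.span ℝ {v})ᗮ.reflection x
    ((Submodule.span ℝ {v})ᗮ.reflection y)
  rwa [Submodule.reflection_reflection] at h

/-- A reflection acts as `-1` on the complement of its mirror, here the line spanned by `v`. -/
theorem det_householder {v : Eucl n} (hv : v ≠ 0) : (householder v).det = -1 := by
  have h := Submodule.det_reflection (Submodule.span ℝ {v})ᗮ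
  rw [Submodule.orthogonal_orthogonal, finrank_span_singleton hv, pow_one] at h
  rw [← h, ← LinearMap.det_toLin (EuclideanSpace.basisFun (Fin n) ℝ).toBasis]
  congr 1
  ext1 x
  exact congrArg (fun T : Eucl n →L[ℝ] Eucl n => T x) (toEuclideanCLM_householder v)

/-- The list of vectors supplied by the generation theorem may contain zero; such factors are
harmless. -/
theorem householder_zero : householder (0 : Eucl n) = 1 := by
  simp [householder]

/-- Zero has to be excluded: there the determinant jumps from `-1` to `1`. -/
theorem continuous_householder :
    Continuous fun v : {v : Eucl n // v ≠ 0} => householder v.1 := by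
  let L : Matrix (Fin n) (Fin n) ℝ ≃ₗ[ℝ] (Eucl n →L[ℝ] Eucl n) :=
    (Matrix.toEuclideanCLM (n := Fin n) (𝕜 := ℝ)).toAlgEquiv.toLinearEquiv
  have hc : Continuous fun v : {v : Eucl n // v ≠ 0} => 2 / ‖v.1‖ ^ 2 :=
    continuous_const.div (by fun_prop) fun v => pow_ne_zero _ (norm_ne_zero_iff.2 v.2)
  exact L.symm.toContinuousLinearEquiv.continuous.comp (continuous_const.sub
    (hc.smul ((contDiff_smulRight_self contDiff_id).continuous.comp
      continuous_subtype_val)))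

/-- The product of the reflections in two hyperplanes. -/
noncomputable def reflectionPair (u v : {v : Eucl n // v ≠ 0}) : SO n :=
  SO.mk (householder u.1 * householder v.1)
    (by rw [Matrix.transpose_mul, householder_transpose, householder_transpose, mul_assoc,
      ← mul_assoc (householder u.1), householder_mul_self, one_mul, householder_mul_self])
    (by rw [Matrix.det_mul, det_householder u.2, det_householder v.2]; norm_num)

theorem reflectionPair_self (v : {v : Eucl n // v ≠ 0}) : reflectionPair v v = 1 :=
  Subtype.ext (householder_mul_self v.1)

/-- With `v` fixed, let `u` range over the nonzero vectors. They form a connected set in dimension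
at least two, and the value at `u = v` is the identity. -/
theorem reflectionPair_mem_connectedComponent (hn : 1 < n) (u v : {v : Eucl n // v ≠ 0}) :
    reflectionPair u v ∈ connectedComponent (1 : SO n) := by
  have hc : IsConnected ({0}ᶜ : Set (Eucl n)) :=
    isConnected_compl_singleton_of_one_lt_rank (by
      rw [← Module.finrank_eq_rank, finrank_euclideanSpace_fin]; exact_mod_cast hn) 0
  have : PreconnectedSpace {v : Eucl n // v ≠ 0} :=
    isPreconnected_iff_preconnectedSpace.1 hc.isPreconnected
  have hf : Continuous fun u => reflectionPair u v :=
    Continuous.subtype_mk (continuous_householder.mul continuous_const) _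
  exact (isPreconnected_range hf).subset_connectedComponent ⟨v, reflectionPair_self v⟩ ⟨u, rfl⟩

/-- This is the Cartan–Dieudonné theorem in matrix form; the bound on the number of reflections is
not kept. -/
theorem exists_householder_prod (A : SO n) :
    ∃ l : List (Eucl n), A.1 = (l.map householder).prod := by
  -- Orthogonality makes the endomorphism an isometry, and equality of dimensions makes it
  -- invertible.
  let φ : Eucl n ≃ₗᵢ[ℝ] Eucl n := LinearIsometry.toLinearIsometryEquiv
    ⟨(SO.toEnd A : Eucl n →ₗ[ℝ] Eucl n), fun x => by
      have h : ContinuousLinearMap.adjoint (SO.toEnd A) * SO.toEnd A = 1 := by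
        rw [← ContinuousLinearMap.star_eq_adjoint, SO.toEnd, ← map_star, ← map_mul]
        rw [show star A.1 * A.1 = 1 from A.transpose_mul, map_one]
      exact (ContinuousLinearMap.norm_map_iff_adjoint_comp_self _).2 h x⟩ rfl
  obtain ⟨l, -, hl⟩ := φ.reflections_generate_dim
  refine ⟨l, toEuclideanCLM_injective ?_⟩
  have key : ∀ l : List (Eucl n),
      Matrix.toEuclideanCLM (n := Fin n) (𝕜 := ℝ) (l.map householder).prod =
      (l.map fun v => (Submodule.span ℝ {v})ᗮ.reflection).prod.toContinuousLinearEquiv.toContinuousLinearMap := by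
    intro l
    induction l with
    | nil => simp
    | cons v l ih =>
      rw [List.map_cons, List.prod_cons, map_mul, ih, toEuclideanCLM_householder, List.map_cons,
        List.prod_cons]
      rfl
  rw [key, ← hl]
  rfl

instance SO.instConnectedSpace (n : ℕ) : ConnectedSpace (SO n) := by
  rcases le_or_gt n 1 with hn | hn
  -- In dimension zero there is only one matrix; in dimension one the determinant is the only entry.
  · have : Subsingleton (SO n) := ⟨fun A B => by
      have hA := A.det_eq_one
      have hB := B.det_eq_one
      apply Subtype.ext
      interval_cases n
      · exact Subsingleton.elim _ _
      · rw [Matrix.det_fin_one] at hA hB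
        ext i j
        rw [Subsingleton.elim i 0, Subsingleton.elim j 0, hA, hB]⟩
    exact { toNonempty := ⟨1⟩ }
  -- Needed for the identity component to be a subgroup.
  have : IsTopologicalGroup (SO n) := topologicalGroup_of_lieGroup 𝓘(ℝ, SkewModel n) ∞
  let N : Subgroup (SO n) := Subgroup.connectedComponentOfOne (SO n)
  have : Nontrivial (Eucl n) := Module.nontrivial_of_finrank_pos (R := ℝ) (by
    rw [finrank_euclideanSpace_fin]; omega)
  obtain ⟨v, hv⟩ := exists_ne (0 : Eucl n)
  -- One fixed mirror `v` represents the second coset: every product of reflections lies in `N` or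
  -- in `N * householder v`. Induction adds factors on the right, next to the possible `householder
  -- v`, so that normality of `N` is not needed.
  have key : ∀ l : List (Eucl n), ∃ g ∈ N, (l.map householder).prod = g.1 ∨
      (l.map householder).prod = g.1 * householder v := by
    intro l
    induction l using List.reverseRecOn with
    | nil => exact ⟨1, N.one_mem, Or.inl rfl⟩
    | append_singleton l u ih =>
      obtain ⟨g, hg, h⟩ := ih
      rw [List.map_append, List.prod_append, List.map_singleton, List.prod_singleton]
      by_cases hu : u = 0
      · exact ⟨g, hg, by rwa [hu, householder_zero, mul_one]⟩
      rcases h with h | h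
      -- Insert `householder v * householder v = 1` after the new factor.
      · refine ⟨g * reflectionPair ⟨u, hu⟩ ⟨v, hv⟩,
          N.mul_mem hg (reflectionPair_mem_connectedComponent hn _ _), Or.inr ?_⟩
        change _ = g.1 * (householder u * householder v) * householder v
        rw [h, mul_assoc, mul_assoc, householder_mul_self, mul_one]
      · refine ⟨g * reflectionPair ⟨v, hv⟩ ⟨u, hu⟩,
          N.mul_mem hg (reflectionPair_mem_connectedComponent hn _ _), Or.inl ?_⟩
        change _ = g.1 * (householder v * householder u)
        rw [h, mul_assoc]
  refine connectedSpace_iff_connectedComponent.2 ⟨1, Set.eq_univ_of_forall fun A => ?_⟩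
  obtain ⟨l, hl⟩ := exists_householder_prod A
  obtain ⟨g, hg, h | h⟩ := key l
  · rwa [Subtype.ext (hl.trans h)]
  -- The second coset consists of matrices of determinant `-1`.
  · have hd := A.det_eq_one
    rw [hl, h, Matrix.det_mul, SO.det_eq_one, det_householder hv] at hd
    norm_num at hd

end Connected

/-! ### Smooth maps from, into and on a quotient `G ⧸ H`. -/

section QuotientManifold

variable {G E F : Type*} [Group G] [TopologicalSpace G]
    [NormedAddCommGroup E] [NormedSpace ℝ E] [ChartedSpace E G]
    [NormedAddCommGroup F] [NormedSpace ℝ F] {H : Subgroup G} [ChartedSpace F (G ⧸ H)]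

theorem IsQuotientChart.contMDiff_mk (h : ∀ e ∈ atlas F (G ⧸ H), IsQuotientChart E H e) :
    ContMDiff 𝓘(ℝ, E) 𝓘(ℝ, F) ∞ (QuotientGroup.mk : G → G ⧸ H) := by
  intro g
  rw [contMDiffAt_iff_target]
  refine ⟨QuotientGroup.continuous_mk.continuousAt, ?_⟩
  have hopen : IsOpen {a : G | (a : G ⧸ H) ∈ (chartAt F (g : G ⧸ H)).source} :=
    (chartAt F (g : G ⧸ H)).open_source.preimage QuotientGroup.continuous_mk
  simpa [extChartAt, Function.comp_def] using (h _ (chart_mem_atlas F (g : G ⧸ H))).contMDiffOn_comp_mk.contMDiffAt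
    (hopen.mem_nhds (mem_chart_source F (g : G ⧸ H)))

/-- Local smooth sections of the quotient map: precompose with a chart the lift of its inverse that
every admissible chart carries. The function `s` is total, but nothing is claimed about it away from
`q`. -/
theorem IsQuotientChart.exists_contMDiffAt_lift
    [IsManifold 𝓘(ℝ, F) ∞ (G ⧸ H)]
    (h : ∀ e ∈ atlas F (G ⧸ H), IsQuotientChart E H e) (q : G ⧸ H) :
    ∃ s : G ⧸ H → G, ContMDiffAt 𝓘(ℝ, F) 𝓘(ℝ, E) ∞ s q ∧ ∀ᶠ p in 𝓝 q, (s p : G ⧸ H) = p := by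
  have hq := mem_chart_source F q
  obtain ⟨s, hs, hev⟩ := (h _ (chart_mem_atlas F q)).exists_lift _
    ((chartAt F q).map_source hq)
  have hc : ContMDiffAt 𝓘(ℝ, F) 𝓘(ℝ, F) ∞ (chartAt F q) q := by
    simpa [extChartAt, Function.comp_def] using
      (contMDiffAt_extChartAt (I := 𝓘(ℝ, F)) (n := ∞) (x := q))
  refine ⟨s ∘ chartAt F q, hs.comp q hc, ?_⟩
  filter_upwards [((chartAt F q).continuousAt hq).eventually hev,
    (chartAt F q).open_source.mem_nhds hq] with p hp hps
  rw [Function.comp_apply, hp, (chartAt F q).left_inv hps]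

variable {E' H' N : Type*} [NormedAddCommGroup E'] [NormedSpace ℝ E'] [TopologicalSpace H']
    {I : ModelWithCorners ℝ E' H'} [TopologicalSpace N] [ChartedSpace H' N]

/-- The universal property of the quotient: near `q`, the map `f` is its pullback to `G` composed
with a local section. -/
theorem IsQuotientChart.contMDiff_of_comp_mk
    [IsManifold 𝓘(ℝ, F) ∞ (G ⧸ H)]
    (h : ∀ e ∈ atlas F (G ⧸ H), IsQuotientChart E H e) {f : G ⧸ H → N}
    (hf : ContMDiff 𝓘(ℝ, E) I ∞ fun g : G => f g) : ContMDiff 𝓘(ℝ, F) I ∞ f := by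
  intro q
  obtain ⟨s, hs, hev⟩ := exists_contMDiffAt_lift h q
  refine (ContMDiffAt.comp q (hf (s q)) hs).congr_of_eventuallyEq ?_
  filter_upwards [hev] with p hp
  rw [Function.comp_apply, hp]

/-- With a local section `s` near `q`, the action is locally `(g, p) ↦ g * s p` followed by the
quotient map, so its smoothness comes from that of the group multiplication. -/
theorem IsQuotientChart.contMDiff_smul [LieGroup 𝓘(ℝ, E) ∞ G]
    [IsManifold 𝓘(ℝ, F) ∞ (G ⧸ H)]
    (h : ∀ e ∈ atlas F (G ⧸ H), IsQuotientChart E H e) :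
    ContMDiff (𝓘(ℝ, E).prod 𝓘(ℝ, F)) 𝓘(ℝ, F) ∞ fun p : G × (G ⧸ H) => p.1 • p.2 := by
  rintro ⟨g, q⟩
  obtain ⟨s, hs, hev⟩ := exists_contMDiffAt_lift h q
  have h1 : ContMDiffAt (𝓘(ℝ, E).prod 𝓘(ℝ, F)) 𝓘(ℝ, E) ∞
      (fun p : G × (G ⧸ H) => p.1 * s p.2) (g, q) :=
    contMDiffAt_fst.mul (ContMDiffAt.comp (g, q) (by exact hs) contMDiffAt_snd)
  refine (ContMDiffAt.comp (g, q) (contMDiff_mk h (g * s q)) h1).congr_of_eventuallyEq ?_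
  filter_upwards [continuousAt_snd.eventually hev] with p hp
  change p.1 • p.2 = ((p.1 * s p.2 : G) : G ⧸ H)
  conv_lhs => rw [← hp]
  rfl

end QuotientManifold

/-! ### The diffeomorphism between cosets and flags. -/

section FlagDiffeomorphism

variable {d n : ℕ} {k : Fin d → ℕ}

theorem finrank_quotientFlag (hle : ∀ i, k i ≤ n) (q : SO n ⧸ blockSO k n) (i : Fin d) :
    Module.finrank ℝ (quotientFlag q i) = k i := by
  obtain ⟨A, rfl⟩ := QuotientGroup.mk_surjective q
  change Module.finrank ℝ (prefixSpan (k i) (SO.frame A)) = k i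
  rw [finrank_prefixSpan A.frame_orthonormal.linearIndependent,
    Fintype.card_congr (β := Fin (k i)) ⟨fun a => ⟨a.1, a.2⟩,
      fun a => ⟨⟨a, a.2.trans_le (hle i)⟩, a.2⟩, fun _ => rfl, fun _ => rfl⟩, Fintype.card_fin]

theorem strictMono_quotientFlag (hmono : StrictMono k) (hle : ∀ i, k i ≤ n)
    (q : SO n ⧸ blockSO k n) : StrictMono (quotientFlag q) := by
  intro i j hij
  refine lt_of_le_of_ne ?_ fun h => ?_
  · obtain ⟨A, rfl⟩ := QuotientGroup.mk_surjective q
    exact prefixSpan_le_iff.2 fun b hb => self_mem_prefixSpan (hb.trans (hmono hij))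
  -- Equality of two members would force equal dimensions.
  · have h2 := finrank_quotientFlag hle q i
    rw [h, finrank_quotientFlag hle q j] at h2
    exact (hmono hij).ne' h2

/-- The flag spanned by the leading columns of a representative of a coset. -/
noncomputable def flagOfQuotient (hmono : StrictMono k) (hle : ∀ i, k i ≤ n)
    (q : SO n ⧸ blockSO k n) : FlagManifold k n :=
  ⟨quotientFlag q, strictMono_quotientFlag hmono hle q, finrank_quotientFlag hle q⟩

theorem flagOfQuotient_injective (hmono : StrictMono k) (hle : ∀ i, k i ≤ n) :
    Function.Injective (flagOfQuotient hmono hle) := by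
  intro p q h
  obtain ⟨A, rfl⟩ := QuotientGroup.mk_surjective p
  obtain ⟨B, rfl⟩ := QuotientGroup.mk_surjective q
  exact QuotientGroup.eq.2 ((SO.inv_mul_mem_iff A B).2 (congrFun (congrArg Subtype.val h)))

/-- The passage from `w` to a rotation only rescales the first vector by `±1`, so leading spans
survive. This serves both surjectivity and the local formula for the inverse. -/
theorem flagOfQuotient_ofFrame (hmono : StrictMono k) (hle : ∀ i, k i ≤ n) {w : Fin n → Eucl n}
    (hw : Orthonormal ℝ w) {V : FlagManifold k n} (h : ∀ i, prefixSpan (k i) w = V.1 i) :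
    flagOfQuotient hmono hle (SO.ofFrame w hw : SO n ⧸ blockSO k n) = V := by
  refine Subtype.ext (funext fun i => ?_)
  change prefixSpan (k i) (SO.frame (SO.ofFrame w hw)) = V.1 i
  rw [SO.frame_ofFrame, prefixSpan_positiveFrame hw, h]

theorem flagOfQuotient_surjective (hmono : StrictMono k) (hle : ∀ i, k i ≤ n) :
    Function.Surjective (flagOfQuotient hmono hle) := fun V =>
  let ⟨_, hv, hvV⟩ := exists_adapted_frame V.mono V.2.2
  ⟨_, flagOfQuotient_ofFrame hmono hle hv hvV⟩

/-- Pulled back to `SO n` and read in the projections, the map is `leadingProj k ∘ SO.toEnd`,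
quadratic in the columns. -/
theorem contMDiff_flagOfQuotient (hmono : StrictMono k) (hle : ∀ i, k i ≤ n) :
    ContMDiff 𝓘(ℝ, CellModel k n) 𝓘(ℝ, CellModel k n) ∞ (flagOfQuotient hmono hle) := by
  refine IsSubmanifoldChart.contMDiff_of_comp (F := CellModel k n)
    (ι := FlagManifold.toEnd (k := k) (n := n)) FlagManifold.isInducing_toEnd (fun _ h => h) ?_
  refine IsQuotientChart.contMDiff_of_comp_mk (E := SkewModel n) (F := CellModel k n)
    (H := blockSO k n) (fun _ h => h) ?_
  exact (contDiff_leadingProj.contMDiff.comp (SO.contMDiff_toEnd n)).congr starProjection_frame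

/-- Around each flag the inverse has a closed form: cell coordinates, then the orthonormalised frame
with these coordinates, then its rotation, then the coset. -/
theorem contMDiff_symm_flagOfQuotient (hmono : StrictMono k) (hle : ∀ i, k i ≤ n) :
    ContMDiff 𝓘(ℝ, CellModel k n) 𝓘(ℝ, CellModel k n) ∞
      (Equiv.ofBijective (flagOfQuotient hmono hle)
        ⟨flagOfQuotient_injective hmono hle, flagOfQuotient_surjective hmono hle⟩).symm := by
  intro V
  obtain ⟨v, hv, hvV⟩ := exists_adapted_frame V.mono V.2.2
  -- The cell is centred at `V`: the projections being compared coincide, and a subspace is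
  -- complementary to its own orthogonal complement.
  have hV : FlagManifold.toEnd V ∈ cellSet k v := fun i => by
    have h : (prefixSpan (k i) v).starProjection = (V.1 i).starProjection := by simp only [hvV i]
    rw [h]
    exact isUnit_compareOp rfl (Submodule.orthogonal_disjoint _)
  have hι : ContMDiff 𝓘(ℝ, CellModel k n) 𝓘(ℝ, Fin d → Eucl n →L[ℝ] Eucl n) ∞
      (FlagManifold.toEnd (k := k) (n := n)) :=
    IsSubmanifoldChart.contMDiff_embedding FlagManifold.isInducing_toEnd.continuous fun _ h => h
  have hs := (IsQuotientChart.contMDiff_mk (E := SkewModel n) (F := CellModel k n)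
    (H := blockSO k n) fun _ h => h).comp
      (contMDiff_ofFrame (contDiff_orthoFrame (k := k) hv) (orthoFrame_orthonormal hv))
  have hc : ContMDiffAt 𝓘(ℝ, Fin d → Eucl n →L[ℝ] Eucl n) 𝓘(ℝ, CellModel k n) ∞
      (cellCoord k v) (FlagManifold.toEnd V) :=
    ((contDiffOn_cellCoord k v).contDiffAt ((isOpen_cellSet k v).mem_nhds hV)).contMDiffAt
  refine ((hs _).comp V (hc.comp V (hι V))).congr_of_eventuallyEq ?_
  -- The cell is open, so flags `W` near `V` lie in it; there it suffices that the rotation given by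
  -- the formula has flag `W`.
  filter_upwards [hι.continuous.continuousAt.eventually ((isOpen_cellSet k v).mem_nhds hV)]
    with W hW
  rw [Equiv.symm_apply_eq]
  refine (flagOfQuotient_ofFrame hmono hle (orthoFrame_orthonormal hv _) fun i => ?_).symm
  -- Gram–Schmidt preserves leading spans, which leaves the fact that cell coordinates recover the
  -- flag.
  rw [orthoFrame, prefixSpan_gramSchmidtNormed]
  exact cellFrame_cellCoord hv W.mono (fun i => by rw [W.2.2, hvV, V.2.2]) hW i

/-- The flag manifold is diffeomorphic to the homogeneous space of cosets of block matrices. -/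
noncomputable def flagDiffeomorph (hmono : StrictMono k) (hle : ∀ i, k i ≤ n) :
    FlagManifold k n ≃ₘ⟮𝓘(ℝ, CellModel k n), 𝓘(ℝ, CellModel k n)⟯ (SO n ⧸ blockSO k n) where
  toEquiv := (Equiv.ofBijective (flagOfQuotient hmono hle)
    ⟨flagOfQuotient_injective hmono hle, flagOfQuotient_surjective hmono hle⟩).symm
  contMDiff_toFun := contMDiff_symm_flagOfQuotient hmono hle
  contMDiff_invFun := contMDiff_flagOfQuotient hmono hle

end FlagDiffeomorphism

theorem mainTheorem8 {d n : ℕ} (k : Fin d → ℕ) (hpos : ∀ i, 0 < k i) (hmono : StrictMono k)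
    (hlt : ∀ i, k i < n) :
    (LieGroup 𝓘(ℝ, SkewModel n) ∞ (SO n) ∧ CompactSpace (SO n) ∧ ConnectedSpace (SO n)) ∧
    ContMDiff (𝓘(ℝ, SkewModel n).prod 𝓘(ℝ, CellModel k n)) 𝓘(ℝ, CellModel k n) ∞
      (fun p : SO n × (SO n ⧸ blockSO k n) => p.1 • p.2) ∧
    Nonempty (FlagManifold k n ≃ₘ⟮𝓘(ℝ, CellModel k n), 𝓘(ℝ, CellModel k n)⟯
      (SO n ⧸ blockSO k n)) :=
  ⟨⟨inferInstance, inferInstance, inferInstance⟩,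
    IsQuotientChart.contMDiff_smul (E := SkewModel n) (F := CellModel k n) (H := blockSO k n)
      fun _ h => h,
    ⟨flagDiffeomorph hmono fun i => (hlt i).le⟩⟩
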